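/- For $d\ge 1$ let $M^{(1)},\dots,M^{(d)}$ be $2\times 2$ matrices whose $4d$ entries $x^{(i)}_{j,k}$ ($i\in[d]$, $j,k\in[2]$) are distinct variables, let $M=M^{(1)}\cdots M^{(d)}$, and let $\mathrm{IMM}_d=M(1,1)+M(1,2)$, a polynomial over a field $\mathbb F$. An algebraic formula over $\mathbb F$ is a tree whose leaves (input gates) are labelled by variables or field constants and whose internal gates are sum gates (computing linear combinations of their children) and product gates, of unbounded fan-in. Its size is its number of gates, including input gates; its product-depth is the maximum number of product gates on a path from a leaf to the output gate. It is multilinear if every gate computes a polynomial of degree at most $1$ in each variable (it need not be syntactically multilinear). There is an absolute constant $c>0$ such that for every field $\mathbb F$ and all integers $d\ge 1$ and $\Delta$ with $1\le\Delta\le\log_2 d$, every multilinear formula over $\mathbb F$ of product-depth at most $\Delta$ that computes $\mathrm{IMM}_d$ has size at least $2^{c\,\Delta\, d^{1/\Delta}}$. Consequently, for every polynomial $p$ with coefficients in $\mathbb N$ there is a constant $c'>0$, depending only on $p$, such that for every field $\mathbb F$ and every $d\ge 1$, every multilinear formula over $\mathbb F$ of size at most $p(d)$ that computes $\mathrm{IMM}_d$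 has product-depth at least $c'\log_2 d$. -/

import Mathlib

/-- A polynomial is multilinear if its degree in each variable is at most one. -/
def IsMultilinearPoly {X R : Type*} [CommSemiring R] (p : MvPolynomial X R) : Prop :=
  ∀ x : X, p.degreeOf x ≤ 1

/-- Algebraic formulas over `R` in the variables `X`. Leaves (input gates) are labelled by
variables or constants. Sum and product gates have unbounded fan-in; the wires entering a sum
gate carry scalar weights, so that a sum gate outputs a linear combination of its children (an
unweighted sum gate is one all of whose weights are `1`). The inductive type consists of trees,
so every gate is used at most once. -/
inductive ArithFormula (R X : Type*) where
  | var (x : X) : ArithFormula R X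
  | const (a : R) : ArithFormula R X
  | sum (n : ℕ) (w : Fin n → R) (child : Fin n → ArithFormula R X) : ArithFormula R X
  | prod (n : ℕ) (child : Fin n → ArithFormula R X) : ArithFormula R X

namespace ArithFormula

variable {R X : Type*}

/-- The polynomial computed at the output gate. -/
noncomputable def poly [CommSemiring R] : ArithFormula R X → MvPolynomial X R
  | var x => MvPolynomial.X x
  | const a => MvPolynomial.C a
  | sum _ w child => ∑ i, MvPolynomial.C (w i) * (child i).poly
  | prod _ child => ∏ i, (child i).poly

/-- The number of gates, input gates included. -/
def size : ArithFormula R X → ℕ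
  | var _ => 1
  | const _ => 1
  | sum _ _ child => 1 + ∑ i, (child i).size
  | prod _ child => 1 + ∑ i, (child i).size

/-- The maximum number of product gates on a path from a leaf to the output gate. -/
def productDepth : ArithFormula R X → ℕ
  | var _ => 0
  | const _ => 0
  | sum _ _ child => Finset.univ.sup fun i => (child i).productDepth
  | prod _ child => 1 + Finset.univ.sup fun i => (child i).productDepth

/-- A formula is multilinear if every one of its gates computes a multilinear polynomial.
(Leaves always do.) Nothing is required of the sets of variables that occur syntactically. -/
def IsMultilinear [CommSemiring R] : ArithFormula R X → Prop
  | var _ => True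
  | const _ => True
  | sum n w child => IsMultilinearPoly (sum n w child).poly ∧ ∀ i, (child i).IsMultilinear
  | prod n child => IsMultilinearPoly (prod n child).poly ∧ ∀ i, (child i).IsMultilinear

end ArithFormula

/-- The index set of the `4 * d` variables: `(i, j, k)` indexes the `(j, k)` entry of the `i`-th
matrix (all indices counted from zero). -/
abbrev IMMVar (d : ℕ) : Type := Fin d × Fin 2 × Fin 2

/-- The `i`-th generic `2 × 2` matrix. -/
noncomputable def immMatrix (R : Type*) [CommSemiring R] (d : ℕ) (i : Fin d) :
    Matrix (Fin 2) (Fin 2) (MvPolynomial (IMMVar d) R) :=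
  Matrix.of fun j k => MvPolynomial.X (i, j, k)

/-- The iterated matrix multiplication polynomial: the sum of the two entries in the first row of
the product, in order, of the `d` generic `2 × 2` matrices. -/
noncomputable def IMM (R : Type*) [CommSemiring R] (d : ℕ) : MvPolynomial (IMMVar d) R :=
  (List.ofFn (immMatrix R d)).prod 0 0 + (List.ofFn (immMatrix R d)).prod 0 1

/-! The proof measures a polynomial by the rank of a random restriction. A restriction is a path of
states, one before each matrix. A state names a coordinate of the row vector of partial products and
says whether a variable is pending. A variable on the path becomes free of the first kind where a
pending period starts and free of the second kind where one ends; all others become constants. The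
restricted polynomial is then a function of two groups of Boolean arguments, and `relRank` is its
rank divided by `2 ^ (n / 2)`, where `n` is the number of free variables. Since the values used are
explicit points, everything works over any field.

For `IMM` every restriction is good: the values can be arranged so that the restricted polynomial
tests `S ⊆ T` for sets of free variables. The inclusion matrix is unitriangular, and the two kinds
are equally numerous, so `relRank` is at least `1` (`one_le_relRank_IMM`).

For formulas, `relRank` is subadditive at sum gates. At a nonzero product gate multilinearity forces
the children to have disjoint variables, so `relRank` is submultiplicative along a partition of the
variables. A factor whose numbers of variables of the two kinds differ loses `√2`
(`relRank_le_eventWeight`). An affine polynomial has rank at most two and so loses `√2` for each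
chunk of variables with three active members (`exists_family_affine`). Each such event, apart from a
bounded number, can be forced by resampling at most six states, and this interferes with boundedly
many other events. The expected product of losses therefore decays exponentially in the number of
disjoint factors (`sum_prod_factorEvent_le`).

The induction `sum_relRank_formula_le` follows the largest child at each product gate and charges
one loss to every sibling. By the weighted AM-GM inequality this yields of order `Δ * (N ^ (1/Δ) -
1)` factors for `N` variables. Comparing with `IMM` gives the size bound, and the depth bound
follows by solving it for `Δ`. -/

/-- The square root of one half. -/
noncomputable def invSqrtTwo : ℝ := √(1 / 2)

lemma invSqrtTwo_mul_self : invSqrtTwo * invSqrtTwo = 1 / 2 :=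
  Real.mul_self_sqrt (by norm_num)

lemma invSqrtTwo_pos : 0 < invSqrtTwo := Real.sqrt_pos.2 (by norm_num)

lemma invSqrtTwo_lt_one : invSqrtTwo < 1 := by
  nlinarith [invSqrtTwo_mul_self, invSqrtTwo_pos]

/-- The weight of an event: `invSqrtTwo` if it occurs and `1` otherwise. -/
noncomputable def eventWeight (P : Prop) : ℝ :=
  open Classical in if P then invSqrtTwo else 1

lemma eventWeight_pos (P : Prop) : 0 < eventWeight P := by
  unfold eventWeight; split_ifs
  · exact invSqrtTwo_pos
  · exact one_pos

lemma eventWeight_le_one (P : Prop) : eventWeight P ≤ 1 := by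
  unfold eventWeight; split_ifs
  · exact invSqrtTwo_lt_one.le
  · exact le_rfl

/-- The exponential rate at which a product of event weights decays. -/
noncomputable def decayRate : ℝ := (1 - invSqrtTwo) / 4 ^ 6 / 49

lemma decayRate_pos : 0 < decayRate := by
  unfold decayRate
  have := invSqrtTwo_lt_one
  have : 0 < 1 - invSqrtTwo := by linarith
  positivity

/-! ### Resampling and exponential decay of expected weights -/

section Resampling

variable {ι S : Type*} [Fintype ι] [DecidableEq ι] [Fintype S]

/-- Swapping the coordinates in `C` between two independent uniform points is an involution of the
pairs, so the resampled point is again uniform. -/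
lemma sum_sum_piecewise (C : Finset ι) (F : (ι → S) → ℝ) :
    ∑ ω : ι → S, ∑ ω' : ι → S, F (C.piecewise ω' ω) =
      Fintype.card (ι → S) * ∑ ω : ι → S, F ω := by
  have hinv : Function.Involutive
      (fun p : (ι → S) × (ι → S) => (C.piecewise p.2 p.1, C.piecewise p.1 p.2)) := by
    rintro ⟨ω, ω'⟩
    ext i <;> by_cases hi : i ∈ C <;> simp [Finset.piecewise, hi]
  rw [← Fintype.sum_prod_type' (f := fun ω ω' => F (C.piecewise ω' ω))]
  rw [Fintype.sum_equiv hinv.toPerm (fun p : (ι → S) × (ι → S) => F (C.piecewise p.2 p.1))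
    (fun p => F p.1) (fun p => rfl)]
  rw [Fintype.sum_prod_type]
  simp [Finset.mul_sum]

lemma card_le_card_filter_agree [DecidableEq S] (C : Finset ι) (σ : ι → S) :
    Fintype.card (ι → S) ≤
      (Finset.univ.filter fun ω : ι → S => ∀ i ∈ C, ω i = σ i).card * Fintype.card S ^ C.card := by
  have h : (Finset.univ.filter fun ω : ι → S => ∀ i ∈ C, ω i = σ i) =
      Fintype.piFinset fun i => if i ∈ C then {σ i} else Finset.univ := by
    ext ω
    simp only [Finset.mem_filter, Finset.mem_univ, true_and, Fintype.mem_piFinset]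
    refine forall_congr' fun i => ?_
    by_cases hi : i ∈ C <;> simp [hi]
  rw [h, Fintype.card_piFinset, Fintype.card_fun, ← Finset.prod_const]
  have h2 : ∏ _i ∈ C, Fintype.card S = ∏ i, if i ∈ C then Fintype.card S else 1 := by
    simp [Finset.prod_ite_mem]
  rw [h2, ← Finset.prod_mul_distrib, ← Finset.card_univ (α := ι), ← Finset.prod_const]
  refine Finset.prod_le_prod' fun i _ => ?_
  by_cases hi : i ∈ C <;> simp [hi]

/-- The resampled coordinates hit a forcing assignment with probability at least `4 ^ (-6)`, and
then the weight drops by `1 - invSqrtTwo`. The 49 in `decayRate` makes this single gain pay for 49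
factors. -/
lemma sum_eventWeight_piecewise_le (hS : Fintype.card S = 4) (C : Finset ι) (hC : C.card ≤ 6)
    (E : (ι → S) → Prop) (ω : ι → S) (h : ∃ σ : ι → S, E (C.piecewise σ ω)) :
    ∑ ω' : ι → S, eventWeight (E (C.piecewise ω' ω)) ≤
      Real.exp (-(49 * decayRate)) * Fintype.card (ι → S) := by
  classical
  obtain ⟨σ, hσ⟩ := h
  set A := Finset.univ.filter fun ω' : ι → S => ∀ i ∈ C, ω' i = σ i with hA
  have hle : ∀ ω' : ι → S, eventWeight (E (C.piecewise ω' ω)) ≤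
      1 - if ω' ∈ A then (1 - invSqrtTwo) else 0 := by
    intro ω'
    by_cases hm : ω' ∈ A
    · have he : C.piecewise ω' ω = C.piecewise σ ω := by
        ext1 i
        by_cases hi : i ∈ C
        · simp [hi, (Finset.mem_filter.1 hm).2 i hi]
        · simp [hi]
      rw [he, if_pos hm, eventWeight, if_pos hσ]
      linarith
    · rw [if_neg hm, sub_zero]
      exact eventWeight_le_one _
  have hcard : (Fintype.card (ι → S) : ℝ) ≤ A.card * 4 ^ 6 := by
    have h1 := card_le_card_filter_agree C σ
    rw [hS] at h1
    have h2 : Fintype.card (ι → S) ≤ A.card * 4 ^ 6 :=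
      h1.trans (Nat.mul_le_mul_left _ (Nat.pow_le_pow_right (by norm_num) hC))
    exact_mod_cast h2
  calc ∑ ω' : ι → S, eventWeight (E (C.piecewise ω' ω))
      ≤ ∑ ω' : ι → S, (1 - if ω' ∈ A then (1 - invSqrtTwo) else 0) :=
        Finset.sum_le_sum fun ω' _ => hle ω'
    _ = Fintype.card (ι → S) - A.card * (1 - invSqrtTwo) := by
        rw [Finset.sum_sub_distrib, Finset.sum_ite_mem]
        simp [mul_sub]
    _ ≤ (1 - 49 * decayRate) * Fintype.card (ι → S) := by
        have := invSqrtTwo_lt_one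
        have h49 : 49 * decayRate = (1 - invSqrtTwo) / 4 ^ 6 := by unfold decayRate; ring
        rw [h49]
        have : (1 - invSqrtTwo) * Fintype.card (ι → S) ≤ (1 - invSqrtTwo) * (A.card * 4 ^ 6) :=
          mul_le_mul_of_nonneg_left hcard (by linarith)
        linarith
    _ ≤ _ := by
        refine mul_le_mul_of_nonneg_right ?_ (Nat.cast_nonneg _)
        have := Real.add_one_le_exp (-(49 * decayRate))
        linarith

/-- If each event of a finite family can be forced by resampling at most six coordinates, on which
all but at most 49 of the other events do not depend, then the expected product of
the weights decays exponentially in the size of the family. -/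
theorem sum_prod_eventWeight_le {I : Type*} [DecidableEq I] (hS : Fintype.card S = 4)
    (E : I → (ι → S) → Prop) (𝓖 : Finset I)
    (hE : ∀ p ∈ 𝓖, ∃ C : Finset ι, C.card ≤ 6 ∧ (∀ ω, ∃ σ, E p (C.piecewise σ ω)) ∧
      ∃ R : Finset I, p ∈ R ∧ R.card ≤ 49 ∧
        ∀ q ∈ 𝓖, q ∉ R → ∀ σ ω, E q (C.piecewise σ ω) ↔ E q ω) :
    ∑ ω : ι → S, ∏ p ∈ 𝓖, eventWeight (E p ω) ≤
      Real.exp (-(decayRate * 𝓖.card)) * Fintype.card (ι → S) := by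
  induction 𝓖 using Finset.strongInduction with
  | H 𝓖 ih =>
  rcases 𝓖.eq_empty_or_nonempty with rfl | ⟨p, hp⟩
  · simp
  obtain ⟨C, hC, hforce, R, hpR, hR, hinv⟩ := hE p hp
  rcases isEmpty_or_nonempty (ι → S) with hemp | hne
  · simp
  have hcardpos : (0 : ℝ) < Fintype.card (ι → S) := by exact_mod_cast Fintype.card_pos
  have hss : 𝓖 \ R ⊂ 𝓖 := by
    refine (Finset.ssubset_iff_of_subset Finset.sdiff_subset).2 ⟨p, hp, ?_⟩
    simp [hpR]
  have ih' := ih (𝓖 \ R) hss (fun q hq => by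
    obtain ⟨C', h1, h2, R', h3, h4, h5⟩ := hE q (Finset.sdiff_subset hq)
    exact ⟨C', h1, h2, R', h3, h4, fun r hr => h5 r (Finset.sdiff_subset hr)⟩)
  set G : (ι → S) → ℝ := fun ω => ∏ q ∈ 𝓖 \ R, eventWeight (E q ω) with hG
  have hG0 : ∀ ω, 0 ≤ G ω := fun ω => Finset.prod_nonneg fun q _ => (eventWeight_pos _).le
  have hGC : ∀ σ ω, G (C.piecewise σ ω) = G ω := by
    intro σ ω
    refine Finset.prod_congr rfl fun q hq => ?_
    rw [Finset.mem_sdiff] at hq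
    rw [propext (hinv q hq.1 hq.2 σ ω)]
  -- The other members of `R` are given up: their weights are at most one.
  have hstep : ∀ ω, ∏ q ∈ 𝓖, eventWeight (E q ω) ≤ eventWeight (E p ω) * G ω := by
    intro ω
    have hp' : p ∉ 𝓖 \ R := by simp [hpR]
    change _ ≤ eventWeight (E p ω) * ∏ q ∈ 𝓖 \ R, eventWeight (E q ω)
    rw [← Finset.prod_insert (f := fun q => eventWeight (E q ω)) hp']
    refine Finset.prod_le_prod_of_subset_of_le_one ?_ (fun q _ => (eventWeight_pos _).le)
      (fun q _ _ => eventWeight_le_one _)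
    exact Finset.insert_subset hp Finset.sdiff_subset
  -- Resampling on `C` preserves the uniform distribution and does not change `G`, so the weight of
  -- `E p` can be averaged over the resampled coordinates alone.
  have hmain : (Fintype.card (ι → S) : ℝ) * ∑ ω : ι → S, eventWeight (E p ω) * G ω ≤
      Fintype.card (ι → S) * (Real.exp (-(49 * decayRate)) * ∑ ω : ι → S, G ω) := by
    rw [← sum_sum_piecewise C]
    calc ∑ ω : ι → S, ∑ ω' : ι → S,
          eventWeight (E p (C.piecewise ω' ω)) * G (C.piecewise ω' ω)
        = ∑ ω : ι → S, (∑ ω' : ι → S, eventWeight (E p (C.piecewise ω' ω))) * G ω := by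
          simp_rw [hGC, Finset.sum_mul]
      _ ≤ ∑ ω : ι → S, (Real.exp (-(49 * decayRate)) * Fintype.card (ι → S)) * G ω :=
          Finset.sum_le_sum fun ω _ => mul_le_mul_of_nonneg_right
            (sum_eventWeight_piecewise_le hS C hC (E p) ω (hforce ω)) (hG0 ω)
      _ = _ := by rw [← Finset.mul_sum]; ring
  have hcard : (𝓖.card : ℝ) ≤ (𝓖 \ R).card + 49 := by
    have := Finset.le_card_sdiff R 𝓖
    have : 𝓖.card ≤ (𝓖 \ R).card + 49 := by omega
    exact_mod_cast this
  calc ∑ ω : ι → S, ∏ q ∈ 𝓖, eventWeight (E q ω)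
      ≤ ∑ ω : ι → S, eventWeight (E p ω) * G ω := Finset.sum_le_sum fun ω _ => hstep ω
    _ ≤ Real.exp (-(49 * decayRate)) * ∑ ω : ι → S, G ω :=
        le_of_mul_le_mul_left hmain hcardpos
    _ ≤ Real.exp (-(49 * decayRate)) *
          (Real.exp (-(decayRate * (𝓖 \ R).card)) * Fintype.card (ι → S)) :=
        mul_le_mul_of_nonneg_left ih' (Real.exp_pos _).le
    _ ≤ _ := by
        rw [← mul_assoc, ← Real.exp_add]
        refine mul_le_mul_of_nonneg_right (Real.exp_le_exp.2 ?_) hcardpos.le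
        nlinarith [decayRate_pos]

end Resampling

/-! ### Rank of functions of two arguments -/

section FunctionRank

variable {K A B : Type*} [Field K]

/-- `F` is a sum of `r` functions, each a product of a function of the first and a function of the
second argument. -/
def HasRankLE (F : A → B → K) (r : ℕ) : Prop :=
  ∃ (g : Fin r → A → K) (h : Fin r → B → K), ∀ a b, F a b = ∑ i, g i a * h i b

lemma hasRankLE_of_fintype {ι : Type*} [Fintype ι] {F : A → B → K} (g : ι → A → K) (h : ι → B → K)
    (hF : ∀ a b, F a b = ∑ i, g i a * h i b) : HasRankLE F (Fintype.card ι) := by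
  refine ⟨fun i => g ((Fintype.equivFin ι).symm i), fun i => h ((Fintype.equivFin ι).symm i),
    fun a b => ?_⟩
  rw [hF]
  exact (Equiv.sum_comp (Fintype.equivFin ι).symm fun i => g i a * h i b).symm

/-- The rank of a function of two arguments, viewed as a matrix. -/
noncomputable def functionRank (F : A → B → K) : ℕ := sInf {r | HasRankLE F r}

lemma HasRankLE.functionRank_le {F : A → B → K} {r : ℕ} (h : HasRankLE F r) : functionRank F ≤ r :=
  Nat.sInf_le h

lemma hasRankLE_comp_left {T : Type*} [Fintype T] (φ : A → T) (F : T → B → K) :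
    HasRankLE (fun a b => F (φ a) b) (Fintype.card T) := by
  classical
  refine hasRankLE_of_fintype (fun t a => if φ a = t then 1 else 0) (fun t b => F t b)
    fun a b => ?_
  simp

lemma hasRankLE_comp_right {T : Type*} [Fintype T] (φ : B → T) (F : A → T → K) :
    HasRankLE (fun a b => F a (φ b)) (Fintype.card T) := by
  classical
  refine hasRankLE_of_fintype (fun t a => F a t) (fun t b => if φ b = t then 1 else 0)
    fun a b => ?_
  simp

/-- Finiteness of `A` matters here: the infimum of an empty set of ranks would be the default value
`0`. -/
lemma hasRankLE_functionRank [Fintype A] (F : A → B → K) : HasRankLE F (functionRank F) :=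
  have h : {r | HasRankLE F r}.Nonempty := ⟨_, hasRankLE_comp_left id F⟩
  Nat.sInf_mem h

lemma functionRank_zero : functionRank (fun (_ : A) (_ : B) => (0 : K)) = 0 :=
  Nat.le_zero.1 (HasRankLE.functionRank_le ⟨fun i => i.elim0, fun i => i.elim0, by simp⟩)

lemma functionRank_sum_le [Fintype A] {ι : Type*} [Fintype ι] (w : ι → K) (F : ι → A → B → K) :
    functionRank (fun a b => ∑ i, w i * F i a b) ≤ ∑ i, functionRank (F i) := by
  choose g h hgh using fun i => hasRankLE_functionRank (F i)
  have := hasRankLE_of_fintype (ι := Σ i, Fin (functionRank (F i)))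
    (F := fun a b => ∑ i, w i * F i a b) (fun p a => w p.1 * g p.1 p.2 a) (fun p b => h p.1 p.2 b)
    (fun a b => by
      rw [Fintype.sum_sigma]
      refine Finset.sum_congr rfl fun i _ => ?_
      rw [hgh, Finset.mul_sum]
      exact Finset.sum_congr rfl fun j _ => by ring)
  simpa using this.functionRank_le

lemma functionRank_one_le : functionRank (fun (_ : A) (_ : B) => (1 : K)) ≤ 1 :=
  HasRankLE.functionRank_le ⟨fun _ _ => 1, fun _ _ => 1, by simp⟩

lemma functionRank_mul_le [Fintype A] (F G : A → B → K) :
    functionRank (fun a b => F a b * G a b) ≤ functionRank F * functionRank G := by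
  obtain ⟨g, h, hF⟩ := hasRankLE_functionRank F
  obtain ⟨g', h', hG⟩ := hasRankLE_functionRank G
  have := hasRankLE_of_fintype (ι := Fin (functionRank F) × Fin (functionRank G))
    (F := fun a b => F a b * G a b) (fun p a => g p.1 a * g' p.2 a) (fun p b => h p.1 b * h' p.2 b)
    (fun a b => by
      rw [Fintype.sum_prod_type, hF, hG, Finset.sum_mul_sum]
      exact Finset.sum_congr rfl fun i _ => Finset.sum_congr rfl fun j _ => by ring)
  simpa using this.functionRank_le

lemma functionRank_prod_le [Fintype A] {ι : Type*} (s : Finset ι) (F : ι → A → B → K) :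
    functionRank (fun a b => ∏ i ∈ s, F i a b) ≤ ∏ i ∈ s, functionRank (F i) := by
  classical
  induction s using Finset.induction_on with
  | empty => simpa using functionRank_one_le
  | insert i s hi ih =>
    simp_rw [Finset.prod_insert hi]
    exact (functionRank_mul_le _ _).trans (Nat.mul_le_mul_left _ ih)

/-- A function that contains the inclusion relation between the subsets of an `n`-element set as a
submatrix has rank at least `2 ^ n`. -/
lemma two_pow_card_le_functionRank [Fintype A] {ι : Type*} (Y : Finset ι) [DecidableEq ι]
    (F : A → B → K) (u : Finset ι → A) (v : Finset ι → B)
    (hF : ∀ S ⊆ Y, ∀ T ⊆ Y, F (u S) (v T) = if S ⊆ T then 1 else 0) :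
    2 ^ Y.card ≤ functionRank F := by
  obtain ⟨g, h, hgh⟩ := hasRankLE_functionRank F
  -- A rank decomposition with `r` terms maps coefficient vectors on the subsets of `Y` to `K ^ r`;
  -- injectivity gives the bound by counting dimensions.
  let f : (↥Y.powerset → K) →ₗ[K] (Fin (functionRank F) → K) :=
    { toFun := fun c i => ∑ S, c S * g i (u S)
      map_add' := fun c c' => by
        ext i; simp [add_mul, Finset.sum_add_distrib]
      map_smul' := fun k c => by
        ext i; simp [mul_assoc, Finset.mul_sum] }
  have hinj : Function.Injective f := by
    rw [← LinearMap.ker_eq_bot, LinearMap.ker_eq_bot']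
    intro c hc
    have hsum : ∀ T ⊆ Y, ∑ S : ↥Y.powerset, (if S.1 ⊆ T then c S else 0) = 0 := by
      intro T hT
      calc ∑ S : ↥Y.powerset, (if S.1 ⊆ T then c S else 0)
          = ∑ S : ↥Y.powerset, ∑ i, c S * g i (u S) * h i (v T) := by
            refine Finset.sum_congr rfl fun S _ => ?_
            have := hF S.1 (Finset.mem_powerset.1 S.2) T hT
            rw [hgh] at this
            simp_rw [mul_assoc]
            rw [← Finset.mul_sum, this]
            simp
        _ = ∑ i, (f c i) * h i (v T) := by
            rw [Finset.sum_comm]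
            exact Finset.sum_congr rfl fun i _ => by rw [← Finset.sum_mul]; rfl
        _ = 0 := by simp [hc]
    -- Inclusion is unitriangular: once `c` vanishes on all proper subsets of `T`, the sum over the
    -- subsets of `T` is just `c T`.
    have key : ∀ T : Finset ι, ∀ hT : T ∈ Y.powerset, c ⟨T, hT⟩ = 0 := by
      intro T
      induction T using Finset.strongInduction with
      | H T ih =>
        intro hT
        have h1 := hsum T (Finset.mem_powerset.1 hT)
        rw [Finset.sum_eq_single (⟨T, hT⟩ : ↥Y.powerset)] at h1
        · simpa using h1
        · intro S _ hS
          split_ifs with hST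
          · refine ih S.1 (hST.ssubset_of_ne fun he => hS (Subtype.ext he)) S.2
          · rfl
        · simp
    ext S
    exact key S.1 S.2
  have := LinearMap.finrank_le_finrank_of_injective hinj
  simpa using this

end FunctionRank

/-! ### Random restrictions and the events that lower the rank -/

section Restriction

variable {d : ℕ}

/-- A restriction of the variables of `IMM`, given by the state in which the row vector of partial
products is to be found before each of the matrices. -/
abbrev Restriction (d : ℕ) : Type := Fin d → Bool × Fin 2

/-- The state before the `i`-th matrix. The first and the last state are fixed. The Boolean tells
whether a variable of the first kind is pending, the index is the coordinate of the row vector that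
holds the pending variable, or the only nonzero coordinate if none is pending. -/
def pathState (ω : Restriction d) (i : ℕ) : Bool × Fin 2 :=
  -- The value of `ω` at `0` is never read.
  if h : 0 < i ∧ i < d then ω ⟨i, h.2⟩ else (false, 0)

lemma pathState_of_lt (ω : Restriction d) {i : ℕ} (h0 : 0 < i) (h : i < d) :
    pathState ω i = ω ⟨i, h⟩ := dif_pos ⟨h0, h⟩

/-- The kind of a variable under a restriction: `1` for a variable of the first kind, `-1` for one
of the second kind, and `0` for a variable that is set to a constant. -/
def varSign (ω : Restriction d) (x : IMMVar d) : ℤ :=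
  if (pathState ω x.1).2 = x.2.1 ∧ (pathState ω (x.1 + 1)).2 = x.2.2 then
    (pathState ω (x.1 + 1)).1.toInt - (pathState ω x.1).1.toInt else 0

lemma varSign_cases (ω : Restriction d) (x : IMMVar d) :
    varSign ω x = 0 ∨ varSign ω x = 1 ∨ varSign ω x = -1 := by
  unfold varSign
  split_ifs
  · cases (pathState ω (x.1 + 1)).1 <;> cases (pathState ω x.1).1 <;> simp
  · simp

/-- The variables of the first kind. -/
def posVars (V : Finset (IMMVar d)) (ω : Restriction d) : Finset (IMMVar d) :=
  V.filter fun x => varSign ω x = 1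

/-- The variables of the second kind. -/
def negVars (V : Finset (IMMVar d)) (ω : Restriction d) : Finset (IMMVar d) :=
  V.filter fun x => varSign ω x = -1

/-- The variables that are not set to constants. -/
def activeVars (V : Finset (IMMVar d)) (ω : Restriction d) : Finset (IMMVar d) :=
  V.filter fun x => varSign ω x ≠ 0

lemma card_activeVars (V : Finset (IMMVar d)) (ω : Restriction d) :
    (activeVars V ω).card = (posVars V ω).card + (negVars V ω).card := by
  unfold activeVars posVars negVars
  rw [← Finset.card_union_of_disjoint, ← Finset.filter_or]
  · congr 1
    refine Finset.filter_congr fun x _ => ?_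
    rcases varSign_cases ω x with h | h | h <;> simp [h]
  · exact Finset.disjoint_filter.2 fun x _ h h' => by omega

lemma card_posVars_sub_card_negVars (V : Finset (IMMVar d)) (ω : Restriction d) :
    ((posVars V ω).card : ℤ) - (negVars V ω).card = ∑ x ∈ V, varSign ω x := by
  unfold posVars negVars
  rw [Finset.card_filter, Finset.card_filter]
  push_cast
  rw [← Finset.sum_sub_distrib]
  refine Finset.sum_congr rfl fun x _ => ?_
  rcases varSign_cases ω x with h | h | h <;> simp [h]

/-- The variables whose kind may depend on the coordinates in `C`. -/
def touchedVars (C : Finset (Fin d)) : Finset (IMMVar d) :=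
  C.biUnion fun c => (Finset.univ.filter fun x : IMMVar d => x.1.val = c) ∪
    Finset.univ.filter fun x : IMMVar d => x.1.val + 1 = c

lemma card_matrixVars_le (j a : ℕ) :
    (Finset.univ.filter fun x : IMMVar d => x.1.val + a = j).card ≤ 4 := by
  have := Finset.card_le_card_of_injOn
    (s := Finset.univ.filter fun x : IMMVar d => x.1.val + a = j)
    (t := (Finset.univ : Finset (Fin 2 × Fin 2))) (fun x => x.2) (by simp)
    (by
      rintro ⟨i, k⟩ hx ⟨i', k'⟩ hy h
      simp only [Finset.coe_filter, Finset.mem_univ, true_and, Set.mem_ofPred_eq] at hx hy h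
      have : i = i' := Fin.ext (by omega)
      rw [this, h])
  simpa using this

lemma card_touchedVars_le (C : Finset (Fin d)) : (touchedVars C).card ≤ C.card * 8 := by
  refine Finset.card_biUnion_le_card_mul _ _ _ fun c _ => (Finset.card_union_le _ _).trans ?_
  have h1 := card_matrixVars_le (d := d) c 0
  have h2 := card_matrixVars_le (d := d) c 1
  simp only [add_zero] at h1
  omega

lemma varSign_piecewise {C : Finset (Fin d)} {x : IMMVar d} (hx : x ∉ touchedVars C)
    (σ ω : Restriction d) : varSign (C.piecewise σ ω) x = varSign ω x := by
  have h : ∀ c ∈ C, x.1.val ≠ c ∧ x.1.val + 1 ≠ c := by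
    intro c hc
    constructor <;> intro h <;> refine hx (Finset.mem_biUnion.2 ⟨c, hc, ?_⟩) <;> simp [h]
  have hst : ∀ j : ℕ, (∀ c ∈ C, j ≠ c) → pathState (C.piecewise σ ω) j = pathState ω j := by
    intro j hj
    unfold pathState
    split_ifs with h0
    · refine Finset.piecewise_eq_of_notMem _ _ _ fun hc => hj _ hc rfl
    · rfl
  unfold varSign
  rw [hst _ fun c hc => (h c hc).1, hst _ fun c hc => (h c hc).2]

/-- The event attached to a set of variables: for the flag `false`, that the numbers of
variables of the two kinds differ; for the flag `true`, that there are three active variables. -/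
def FactorEvent (p : Finset (IMMVar d) × Bool) (ω : Restriction d) : Prop :=
  if p.2 then 3 ≤ (activeVars p.1 ω).card else ∑ x ∈ p.1, varSign ω x ≠ 0

lemma factorEvent_piecewise {p : Finset (IMMVar d) × Bool} {C : Finset (Fin d)}
    (h : Disjoint p.1 (touchedVars C)) (σ ω : Restriction d) :
    FactorEvent p (C.piecewise σ ω) ↔ FactorEvent p ω := by
  have hx : ∀ x ∈ p.1, varSign (C.piecewise σ ω) x = varSign ω x := fun x hx =>
    varSign_piecewise (Finset.disjoint_left.1 h hx) σ ω
  have h1 : activeVars p.1 (C.piecewise σ ω) = activeVars p.1 ω :=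
    Finset.filter_congr fun x hx' => by rw [hx x hx']
  unfold FactorEvent
  rw [h1, Finset.sum_congr rfl hx]

/-- Three variables with pairwise independent activity. -/
lemma exists_spread_triple {V : Finset (IMMVar d)} (hV : 25 ≤ V.card) :
    ∃ W ⊆ V, W.card = 3 ∧ ∃ (k k' : Fin 2) (b : ℕ), ∀ x ∈ W, 0 < x.1.val ∧ x.1.val + 1 < d ∧
      x.2.1 = k ∧ x.2.2 = k' ∧ x.1.val % 2 = b := by
  set I := V.filter fun x => 0 < x.1.val ∧ x.1.val + 1 < d with hI
  -- The first and the last matrix, adjacent to fixed states, have at most 8 entries, so at least 17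
  -- elements of `V` remain.
  have hIc : 16 < I.card := by
    have hsub : V \ I ⊆ (Finset.univ.filter fun x : IMMVar d => x.1.val + 0 = 0) ∪
        Finset.univ.filter fun x : IMMVar d => x.1.val + 1 = d := by
      intro x hx
      simp only [hI, Finset.mem_sdiff, Finset.mem_filter, not_and, not_lt] at hx
      simp only [Finset.mem_union, Finset.mem_filter, Finset.mem_univ, true_and]
      have := x.1.2
      have := hx.2 hx.1
      omega
    have h1 := (Finset.card_le_card hsub).trans (Finset.card_union_le _ _)
    have h2 := card_matrixVars_le (d := d) 0 0
    have h3 := card_matrixVars_le (d := d) d 1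
    have h4 := Finset.le_card_sdiff I V
    omega
  -- There are 8 classes (parity of the matrix index and position of the entry), so 17 elements put
  -- three into one class.
  obtain ⟨y, -, hy⟩ := Finset.exists_lt_card_fiber_of_mul_lt_card_of_maps_to
    (s := I) (t := (Finset.range 2) ×ˢ (Finset.univ : Finset (Fin 2 × Fin 2)))
    (f := fun x => (x.1.val % 2, x.2)) (n := 2)
    (fun x _ => by simp; omega) (by simpa using hIc)
  obtain ⟨W, hW, hWc⟩ := Finset.exists_subset_card_eq (Nat.succ_le_of_lt hy)
  refine ⟨W, fun x hx => (Finset.mem_filter.1 (Finset.mem_filter.1 (hW hx)).1).1, hWc,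
    y.2.1, y.2.2, y.1, fun x hx => ?_⟩
  have h := Finset.mem_filter.1 (hW hx)
  have h' := (Finset.mem_filter.1 h.1).2
  refine ⟨h'.1, h'.2, ?_, ?_, ?_⟩ <;> rw [← h.2]

/-- Three variables in the same position of different matrices with indices of equal parity have
pairwise distinct end states. All six can therefore be set independently so that a pending period
starts at each variable. -/
lemma exists_force_three_active {V : Finset (IMMVar d)} (hV : 25 ≤ V.card) :
    ∃ C : Finset (Fin d), C.card ≤ 6 ∧ ∀ ω, ∃ σ, FactorEvent (V, true) (C.piecewise σ ω) := by
  obtain ⟨W, hWV, hWc, k, k', b, hW⟩ := exists_spread_triple hV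
  set C : Finset (Fin d) := Finset.univ.filter fun c =>
    c ∈ W.image (fun x => x.1) ∨ c.val ∈ W.image (fun x => x.1.val + 1) with hC
  refine ⟨C, ?_, fun ω => ?_⟩
  · have h1 : C.image Fin.val ⊆ W.image (fun x => x.1.val) ∪ W.image (fun x => x.1.val + 1) := by
      intro j hj
      simp only [hC, Finset.mem_image, Finset.mem_filter, Finset.mem_univ, true_and,
        Finset.mem_union] at hj ⊢
      obtain ⟨c, hc | hc, rfl⟩ := hj
      · obtain ⟨x, hx, rfl⟩ := hc
        exact Or.inl ⟨x, hx, rfl⟩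
      · exact Or.inr hc
    have h2 := (Finset.card_le_card h1).trans (Finset.card_union_le _ _)
    rw [Finset.card_image_of_injective _ Fin.val_injective] at h2
    have h3 : (W.image (fun x => x.1.val)).card ≤ W.card := Finset.card_image_le
    have h4 : (W.image (fun x => x.1.val + 1)).card ≤ W.card := Finset.card_image_le
    omega
  · classical
    set σ : Restriction d := fun c => if c ∈ W.image (fun x => x.1) then (false, k) else (true, k')
    refine ⟨σ, ?_⟩
    have hact : W ⊆ activeVars V (C.piecewise σ ω) := by
      intro x hx
      obtain ⟨h0, h1, hk, hk', hb⟩ := hW x hx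
      refine Finset.mem_filter.2 ⟨hWV hx, ?_⟩
      have e1 : pathState (C.piecewise σ ω) x.1 = (false, k) := by
        have hm : x.1 ∈ W.image (fun x => x.1) := Finset.mem_image_of_mem _ hx
        rw [pathState_of_lt _ h0 x.1.2, Finset.piecewise_eq_of_mem]
        · exact if_pos hm
        · simpa [hC] using Or.inl hm
      have e2 : pathState (C.piecewise σ ω) (x.1 + 1) = (true, k') := by
        have hm : (⟨x.1 + 1, h1⟩ : Fin d) ∉ W.image (fun x => x.1) := by
          intro hm
          obtain ⟨y, hy, hyx⟩ := Finset.mem_image.1 hm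
          have h2 := (hW y hy).2.2.2.2
          have h3 : y.1.val = x.1.val + 1 := congrArg Fin.val hyx
          omega
        rw [pathState_of_lt _ (Nat.succ_pos _) h1, Finset.piecewise_eq_of_mem]
        · exact if_neg hm
        · rw [hC, Finset.mem_filter]
          exact ⟨Finset.mem_univ _, Or.inr (Finset.mem_image.2 ⟨x, hx, rfl⟩)⟩
      simp [varSign, e1, e2, hk, hk']
    have := Finset.card_le_card hact
    simpa [FactorEvent, ← hWc] using this

/-- Toggling the pending bit before matrix `i` changes the kinds of only two variables, those where
the path enters and leaves this state. If only the second lies in `V`, the balance of `V` changes by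
one, so it is nonzero for one of the two settings. -/
lemma exists_force_imbalance {V : Finset (IMMVar d)} {i : ℕ} (h2 : 2 ≤ i) (hi : i + 1 < d)
    {k k' : Fin 2} (hmem : ((⟨i, by omega⟩, k, k') : IMMVar d) ∈ V)
    (hnot : ((⟨i - 1, by omega⟩, 0, k) : IMMVar d) ∉ V) :
    ∃ C : Finset (Fin d), C.card ≤ 6 ∧ ∀ ω, ∃ σ, FactorEvent (V, false) (C.piecewise σ ω) := by
  classical
  set C : Finset (Fin d) := {⟨i - 1, by omega⟩, ⟨i, by omega⟩, ⟨i + 1, hi⟩} with hC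
  refine ⟨C, Finset.card_le_three.trans (by norm_num), fun ω => ?_⟩
  set σ : Bool → Restriction d := fun b c =>
    if c.val = i then (b, k) else if c.val = i + 1 then (false, k') else (false, 0) with hσ
  have e0 : ∀ b, pathState (C.piecewise (σ b) ω) (i - 1) = (false, 0) := by
    intro b
    rw [pathState_of_lt _ (by omega) (by omega), Finset.piecewise_eq_of_mem _ _ _ (by simp [hC])]
    simp only [hσ]
    rw [if_neg (by omega), if_neg (by omega)]
  have e1 : ∀ b, pathState (C.piecewise (σ b) ω) i = (b, k) := by
    intro b
    rw [pathState_of_lt _ (by omega) (by omega), Finset.piecewise_eq_of_mem _ _ _ (by simp [hC])]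
    simp [hσ]
  have e2 : ∀ b, pathState (C.piecewise (σ b) ω) (i + 1) = (false, k') := by
    intro b
    rw [pathState_of_lt _ (by omega) (by omega), Finset.piecewise_eq_of_mem _ _ _ (by simp [hC])]
    simp [hσ]
  have e3 : ∀ b, ∀ j : ℕ, j ≠ i → pathState (C.piecewise (σ b) ω) j =
      pathState (C.piecewise (σ false) ω) j := by
    intro b j hj
    unfold pathState
    split_ifs with h
    · by_cases hm : (⟨j, h.2⟩ : Fin d) ∈ C
      · rw [Finset.piecewise_eq_of_mem _ _ _ hm, Finset.piecewise_eq_of_mem _ _ _ hm]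
        simp [hσ, hj]
      · rw [Finset.piecewise_eq_of_notMem _ _ _ hm, Finset.piecewise_eq_of_notMem _ _ _ hm]
    · rfl
  have hdiff : ∀ x ∈ V, varSign (C.piecewise (σ true) ω) x =
      varSign (C.piecewise (σ false) ω) x +
        if x = ((⟨i, by omega⟩, k, k') : IMMVar d) then -1 else 0 := by
    rintro ⟨⟨j, hj⟩, l, l'⟩ hx
    unfold varSign
    by_cases hji : j = i
    · subst hji
      simp only [e1, e2]
      by_cases hl : k = l ∧ k' = l'
      · obtain ⟨rfl, rfl⟩ := hl
        simp
      · rw [if_neg hl, if_neg hl, if_neg]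
        · rfl
        · intro h
          simp only [Prod.mk.injEq, true_and] at h
          exact hl ⟨h.1.symm, h.2.symm⟩
    · have hne : ((⟨j, hj⟩, l, l') : IMMVar d) ≠ (⟨i, by omega⟩, k, k') := by
        intro h
        exact hji (congrArg (fun y : IMMVar d => y.1.val) h)
      rw [if_neg hne, add_zero]
      by_cases hji' : j + 1 = i
      · have : j = i - 1 := by omega
        subst this
        simp only [hji', e0, e1]
        have hl : ¬ (0 = l ∧ k = l') := by
          rintro ⟨rfl, rfl⟩
          exact hnot hx
        rw [if_neg hl, if_neg hl]
      · simp only [e3 true j hji, e3 true (j + 1) hji']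
  have hsum : ∑ x ∈ V, varSign (C.piecewise (σ true) ω) x =
      ∑ x ∈ V, varSign (C.piecewise (σ false) ω) x - 1 := by
    rw [Finset.sum_congr rfl hdiff, Finset.sum_add_distrib, Finset.sum_ite_eq' V, if_pos hmem]
    ring
  by_cases h0 : ∑ x ∈ V, varSign (C.piecewise (σ false) ω) x = 0
  · refine ⟨σ true, ?_⟩
    simp [FactorEvent, hsum, h0]
  · exact ⟨σ false, by simpa [FactorEvent] using h0⟩

/-- A set of variables whose balance cannot be spoiled locally contains one of few variables. -/
lemma exists_mem_boundary {V : Finset (IMMVar d)} (hV : V.Nonempty)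
    (h : ∀ (i : ℕ) (_ : 2 ≤ i) (hi : i + 1 < d) (k k' : Fin 2),
      ((⟨i, by omega⟩, k, k') : IMMVar d) ∈ V → ((⟨i - 1, by omega⟩, 0, k) : IMMVar d) ∈ V) :
    ∃ x ∈ V, x.1.val < 3 ∨ x.1.val + 1 = d := by
  obtain ⟨⟨⟨i, hi⟩, k, k'⟩, hx⟩ := hV
  induction i generalizing k k' with
  | zero => exact ⟨_, hx, Or.inl (by simp)⟩
  | succ i ih =>
    by_cases h3 : i + 1 < 3
    · exact ⟨_, hx, Or.inl h3⟩
    by_cases hd : i + 1 + 1 = d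
    · exact ⟨_, hx, Or.inr hd⟩
    -- The hypothesis lets one walk back matrix by matrix until one of the first three is reached.
    exact ih _ _ _ (h (i + 1) (by omega) (by omega) k k' hx)

/-- Pairwise disjoint sets that meet `T` have distinct representatives in `T`. -/
lemma card_filter_not_disjoint_le {X I : Type*} [DecidableEq X] (𝓕 : Finset I) (f : I → Finset X)
    (hdisj : ∀ p ∈ 𝓕, ∀ q ∈ 𝓕, p ≠ q → Disjoint (f p) (f q)) (T : Finset X) :
    (𝓕.filter fun p => ¬ Disjoint (f p) T).card ≤ T.card := by
  classical
  have hex : ∀ p ∈ 𝓕.filter (fun p => ¬ Disjoint (f p) T), ∃ x, x ∈ f p ∧ x ∈ T := by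
    intro p hp
    exact Finset.not_disjoint_iff.1 (Finset.mem_filter.1 hp).2
  rcases isEmpty_or_nonempty X with hX | hX
  · rw [Finset.filter_false_of_mem]
    · simp
    · exact fun p _ h => h (by simp [Finset.eq_empty_of_isEmpty])
  choose! g hg using hex
  refine Finset.card_le_card_of_injOn g (fun p hp => (hg p hp).2) ?_
  intro p hp q hq hpq
  by_contra hne
  have := hdisj p (Finset.mem_filter.1 hp).1 q (Finset.mem_filter.1 hq).1 hne
  exact Finset.disjoint_left.1 this (hg p hp).1 (hpq ▸ (hg q hq).1)

/-- The expected product of the weights of a family of pairwise disjoint factors. -/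
theorem sum_prod_factorEvent_le (𝓕 : Finset (Finset (IMMVar d) × Bool))
    (hdisj : ∀ p ∈ 𝓕, ∀ q ∈ 𝓕, p ≠ q → Disjoint p.1 q.1) (hne : ∀ p ∈ 𝓕, p.1.Nonempty)
    (hlarge : ∀ p ∈ 𝓕, p.2 = true → 25 ≤ p.1.card) :
    ∑ ω : Restriction d, ∏ p ∈ 𝓕, eventWeight (FactorEvent p ω) ≤
      Real.exp (-(decayRate * (𝓕.card - 16))) * Fintype.card (Restriction d) := by
  classical
  set 𝓖 := 𝓕.filter fun p => ∃ C : Finset (Fin d), C.card ≤ 6 ∧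
    ∀ ω, ∃ σ, FactorEvent p (C.piecewise σ ω) with h𝓖
  -- A member that cannot be forced contains one of the at most 16 entries of the first three
  -- matrices and the last one; by disjointness there are at most 16 such members.
  have hbad : (𝓕 \ 𝓖).card ≤ 16 := by
    set B := ((Finset.univ.filter fun x : IMMVar d => x.1.val + 0 = 0) ∪
      (Finset.univ.filter fun x : IMMVar d => x.1.val + 0 = 1)) ∪
      ((Finset.univ.filter fun x : IMMVar d => x.1.val + 0 = 2) ∪
      Finset.univ.filter fun x : IMMVar d => x.1.val + 1 = d) with hB
    have hBc : B.card ≤ 16 := by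
      have h1 := card_matrixVars_le (d := d) 0 0
      have h2 := card_matrixVars_le (d := d) 1 0
      have h3 := card_matrixVars_le (d := d) 2 0
      have h4 := card_matrixVars_le (d := d) d 1
      have h5 := Finset.card_union_le (Finset.univ.filter fun x : IMMVar d => x.1.val + 0 = 0)
        (Finset.univ.filter fun x : IMMVar d => x.1.val + 0 = 1)
      have h6 := Finset.card_union_le (Finset.univ.filter fun x : IMMVar d => x.1.val + 0 = 2)
        (Finset.univ.filter fun x : IMMVar d => x.1.val + 1 = d)
      refine (Finset.card_union_le _ _).trans ?_
      omega
    refine (Finset.card_le_card ?_).trans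
      ((card_filter_not_disjoint_le 𝓕 Prod.fst hdisj B).trans hBc)
    rintro ⟨V, t⟩ hp
    rw [Finset.mem_sdiff, h𝓖, Finset.mem_filter] at hp
    obtain ⟨hp, hp'⟩ := hp
    have hp' := fun h => hp' ⟨hp, h⟩
    refine Finset.mem_filter.2 ⟨hp, ?_⟩
    cases t with
    | true => exact absurd (exists_force_three_active (hlarge _ hp rfl)) hp'
    | false =>
      obtain ⟨x, hx, hxB⟩ := exists_mem_boundary (hne _ hp) fun i h2 hi k k' hm => by
        by_contra hnot
        exact hp' (exists_force_imbalance h2 hi hm hnot)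
      refine Finset.not_disjoint_iff.2 ⟨x, hx, ?_⟩
      simp only [hB, Finset.mem_union, Finset.mem_filter, Finset.mem_univ, true_and]
      omega
  have hmain := sum_prod_eventWeight_le (ι := Fin d) (S := Bool × Fin 2) (by simp) FactorEvent 𝓖
    (fun p hp => by
      obtain ⟨hpF, C, hC, hforce⟩ := Finset.mem_filter.1 hp
      -- Six coordinates touch at most 48 variables, hence at most 48 members; together with `p`
      -- this is 49.
      refine ⟨C, hC, hforce, insert p (𝓕.filter fun q => ¬ Disjoint q.1 (touchedVars C)),
        Finset.mem_insert_self _ _, ?_, ?_⟩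
      · refine (Finset.card_insert_le _ _).trans ?_
        have h1 := card_filter_not_disjoint_le 𝓕 Prod.fst hdisj (touchedVars C)
        have h2 := card_touchedVars_le C
        omega
      · intro q hq hqR σ ω
        refine factorEvent_piecewise ?_ σ ω
        by_contra hnd
        exact hqR (Finset.mem_insert_of_mem
          (Finset.mem_filter.2 ⟨(Finset.mem_filter.1 hq).1, hnd⟩)))
  have hcard : (𝓕.card : ℝ) - 16 ≤ 𝓖.card := by
    have := Finset.le_card_sdiff 𝓖 𝓕
    have : 𝓕.card ≤ 𝓖.card + 16 := by omega
    have : (𝓕.card : ℝ) ≤ 𝓖.card + 16 := by exact_mod_cast this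
    linarith
  calc ∑ ω : Restriction d, ∏ p ∈ 𝓕, eventWeight (FactorEvent p ω)
      ≤ ∑ ω : Restriction d, ∏ p ∈ 𝓖, eventWeight (FactorEvent p ω) :=
        Finset.sum_le_sum fun ω _ => Finset.prod_le_prod_of_subset_of_le_one
          (Finset.filter_subset _ _) (fun q _ => (eventWeight_pos _).le)
          (fun q _ _ => eventWeight_le_one _)
    _ ≤ _ := hmain
    _ ≤ _ := by
        refine mul_le_mul_of_nonneg_right (Real.exp_le_exp.2 ?_) (Nat.cast_nonneg _)
        have := mul_le_mul_of_nonneg_left hcard decayRate_pos.le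
        linarith

end Restriction

/-! ### Relative rank and its bounds by event weights -/

section RelativeRank

variable {d : ℕ} {K : Type*} [Field K]

/-- The value of an entry of a matrix that is set to a constant, according to the states before and
after the matrix. -/
def constEntry (K : Type*) [Field K] (s s' : Bool × Fin 2) (k k' : Fin 2) : K :=
  match s.1, s'.1 with
  | false, false => if k = s.2 ∧ k' = s'.2 then 1 else 0
  | false, true => if k = s.2 ∧ k' ≠ s'.2 then 1 else 0
  | true, false => if k ≠ s.2 ∧ k' = s'.2 then 1 else 0
  | true, true => if (k = s.2 ↔ k' = s'.2) then 1 else 0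

/-- The values of the variables under a restriction: those of the first kind take the values `0` and
`1` and depend on `a`, those of the second kind take the values `0` and `-1` and depend on `b`. -/
def restrictedValue (K : Type*) [Field K] (ω : Restriction d) (a b : IMMVar d → Bool)
    (x : IMMVar d) : K :=
  if varSign ω x = 1 then (if a x then 1 else 0)
  else if varSign ω x = -1 then (if b x then 0 else -1)
  else constEntry K (pathState ω x.1) (pathState ω (x.1 + 1)) x.2.1 x.2.2

/-- The values of the variables under a restriction, those outside `V` being set to zero. -/
def restrictedPoint (K : Type*) [Field K] (V : Finset (IMMVar d)) (ω : Restriction d)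
    (a b : IMMVar d → Bool) (x : IMMVar d) : K :=
  if x ∈ V then restrictedValue K ω a b x else 0

/-- The function of `a` and `b` computed by a polynomial under a restriction. -/
noncomputable def restrictedEval (V : Finset (IMMVar d)) (ω : Restriction d)
    (f : MvPolynomial (IMMVar d) K) (a b : IMMVar d → Bool) : K :=
  MvPolynomial.eval (restrictedPoint K V ω a b) f

/-- The rank of a restricted polynomial, divided by the square root of two to the number
of active variables. -/
noncomputable def relRank (V : Finset (IMMVar d)) (ω : Restriction d)
    (f : MvPolynomial (IMMVar d) K) : ℝ :=
  functionRank (restrictedEval V ω f) * invSqrtTwo ^ (activeVars V ω).card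

lemma relRank_nonneg (V : Finset (IMMVar d)) (ω : Restriction d)
    (f : MvPolynomial (IMMVar d) K) : 0 ≤ relRank V ω f :=
  mul_nonneg (Nat.cast_nonneg _) (pow_nonneg invSqrtTwo_pos.le _)

lemma restrictedPoint_congr {V : Finset (IMMVar d)} {ω : Restriction d}
    {a a' b b' : IMMVar d → Bool} (ha : ∀ x ∈ posVars V ω, a x = a' x)
    (hb : ∀ x ∈ negVars V ω, b x = b' x) :
    restrictedPoint K V ω a b = restrictedPoint K V ω a' b' := by
  ext x
  unfold restrictedPoint restrictedValue
  by_cases hV : x ∈ V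
  · by_cases h1 : varSign ω x = 1
    · simp [h1, ha x (Finset.mem_filter.2 ⟨hV, h1⟩)]
    · by_cases h2 : varSign ω x = -1
      · simp [h2, hb x (Finset.mem_filter.2 ⟨hV, h2⟩)]
      · simp [h1, h2]
  · simp [hV]

/-- The first argument matters only through its values on the variables of the first kind, so there
are at most that many distinct rows. -/
lemma functionRank_restrictedEval_le_pos (V : Finset (IMMVar d)) (ω : Restriction d)
    (f : MvPolynomial (IMMVar d) K) :
    functionRank (restrictedEval V ω f) ≤ 2 ^ (posVars V ω).card := by
  classical
  have h := hasRankLE_comp_left (A := IMMVar d → Bool) (B := IMMVar d → Bool)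
    (fun a (x : ↥(posVars V ω)) => a x)
    (fun t b => restrictedEval V ω f (fun x => if h : x ∈ posVars V ω then t ⟨x, h⟩ else false) b)
  have he : (fun a b => restrictedEval V ω f
      (fun x => if x ∈ posVars V ω then a x else false) b) = restrictedEval V ω f := by
    ext a b
    unfold restrictedEval
    rw [restrictedPoint_congr (a' := a) (b' := b)]
    · intro x hx; simp [hx]
    · simp
  simp only [dite_eq_ite] at h
  rw [he] at h
  simpa using h.functionRank_le

lemma functionRank_restrictedEval_le_neg (V : Finset (IMMVar d)) (ω : Restriction d)
    (f : MvPolynomial (IMMVar d) K) :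
    functionRank (restrictedEval V ω f) ≤ 2 ^ (negVars V ω).card := by
  classical
  have h := hasRankLE_comp_right (A := IMMVar d → Bool) (B := IMMVar d → Bool)
    (fun b (x : ↥(negVars V ω)) => b x)
    (fun a t => restrictedEval V ω f a (fun x => if h : x ∈ negVars V ω then t ⟨x, h⟩ else false))
  have he : (fun a b => restrictedEval V ω f a
      (fun x => if x ∈ negVars V ω then b x else false)) = restrictedEval V ω f := by
    ext a b
    unfold restrictedEval
    rw [restrictedPoint_congr (a' := a) (b' := b)]
    · simp
    · intro x hx; simp [hx]
  simp only [dite_eq_ite] at h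
  rw [he] at h
  simpa using h.functionRank_le

lemma two_pow_mul_invSqrtTwo_pow (n : ℕ) : (2 : ℝ) ^ n * invSqrtTwo ^ (n + n) = 1 := by
  rw [← two_mul, pow_mul, ← mul_pow, sq, invSqrtTwo_mul_self]
  norm_num

/-- The rank is at most two to the smaller of the two numbers of free variables, so the relative
rank is at most `invSqrtTwo` to the absolute value of their difference. -/
lemma relRank_le_eventWeight (V : Finset (IMMVar d)) (ω : Restriction d)
    (f : MvPolynomial (IMMVar d) K) : relRank V ω f ≤ eventWeight (FactorEvent (V, false) ω) := by
  have key : ∀ m n r : ℕ, r ≤ 2 ^ m → (r : ℝ) * invSqrtTwo ^ (m + (m + n)) ≤ invSqrtTwo ^ n := by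
    intro m n r hr
    have hr' : (r : ℝ) ≤ 2 ^ m := by exact_mod_cast hr
    calc (r : ℝ) * invSqrtTwo ^ (m + (m + n))
        ≤ 2 ^ m * invSqrtTwo ^ (m + (m + n)) :=
          mul_le_mul_of_nonneg_right hr' (pow_nonneg invSqrtTwo_pos.le _)
      _ = 2 ^ m * invSqrtTwo ^ (m + m) * invSqrtTwo ^ n := by rw [← add_assoc, pow_add]; ring
      _ = _ := by rw [two_pow_mul_invSqrtTwo_pow, one_mul]
  have hpow : ∀ n : ℕ, (FactorEvent (V, false) ω → n ≠ 0) →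
      invSqrtTwo ^ n ≤ eventWeight (FactorEvent (V, false) ω) := by
    intro n hn
    unfold eventWeight
    split_ifs with h
    · exact (pow_le_pow_of_le_one invSqrtTwo_pos.le invSqrtTwo_lt_one.le
        (Nat.one_le_iff_ne_zero.2 (hn h))).trans_eq (pow_one _)
    · exact pow_le_one₀ invSqrtTwo_pos.le invSqrtTwo_lt_one.le
  have himb := card_posVars_sub_card_negVars V ω
  have hev : FactorEvent (V, false) ω → (posVars V ω).card ≠ (negVars V ω).card := by
    intro h he
    simp only [FactorEvent, Bool.false_eq_true, if_false] at h
    rw [he, sub_self] at himb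
    exact h himb.symm
  unfold relRank
  rw [card_activeVars]
  rcases le_total (posVars V ω).card (negVars V ω).card with h | h
  · obtain ⟨n, hn⟩ := Nat.exists_eq_add_of_le h
    rw [hn]
    refine (key _ n _ (functionRank_restrictedEval_le_pos V ω f)).trans (hpow n fun he h0 => ?_)
    exact hev he (by omega)
  · obtain ⟨n, hn⟩ := Nat.exists_eq_add_of_le h
    rw [hn, add_comm (_ + n)]
    refine (key _ n _ (functionRank_restrictedEval_le_neg V ω f)).trans (hpow n fun he h0 => ?_)
    exact hev he (by omega)

lemma relRank_le_one (V : Finset (IMMVar d)) (ω : Restriction d)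
    (f : MvPolynomial (IMMVar d) K) : relRank V ω f ≤ 1 :=
  (relRank_le_eventWeight V ω f).trans (eventWeight_le_one _)

lemma relRank_zero (V : Finset (IMMVar d)) (ω : Restriction d) :
    relRank V ω (0 : MvPolynomial (IMMVar d) K) = 0 := by
  have : restrictedEval V ω (0 : MvPolynomial (IMMVar d) K) = fun _ _ => 0 := by
    ext a b; simp [restrictedEval]
  simp [relRank, this, functionRank_zero]

lemma relRank_sum_le {n : ℕ} (V : Finset (IMMVar d)) (ω : Restriction d) (w : Fin n → K)
    (f : Fin n → MvPolynomial (IMMVar d) K) :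
    relRank V ω (∑ i, MvPolynomial.C (w i) * f i) ≤ ∑ i, relRank V ω (f i) := by
  have : restrictedEval V ω (∑ i, MvPolynomial.C (w i) * f i) =
      fun a b => ∑ i, w i * restrictedEval V ω (f i) a b := by
    ext a b; simp [restrictedEval]
  unfold relRank
  rw [this, ← Finset.sum_mul]
  refine mul_le_mul_of_nonneg_right ?_ (pow_nonneg invSqrtTwo_pos.le _)
  exact_mod_cast functionRank_sum_le w fun i => restrictedEval V ω (f i)

lemma restrictedEval_congr {V U : Finset (IMMVar d)} (hUV : U ⊆ V)
    {f : MvPolynomial (IMMVar d) K} (hf : ∀ x ∈ f.vars, x ∈ V → x ∈ U) (ω : Restriction d) :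
    restrictedEval V ω f = restrictedEval U ω f := by
  ext a b
  refine MvPolynomial.eval₂Hom_congr' rfl (fun x hx _ => ?_) rfl
  unfold restrictedPoint
  by_cases hxV : x ∈ V
  · rw [if_pos hxV, if_pos (hf x hx hxV)]
  · rw [if_neg hxV, if_neg fun h => hxV (hUV h)]

/-- Relative rank is submultiplicative over a partition of the variables. -/
lemma relRank_prod_le {ι : Type*} [Fintype ι] (V : Finset (IMMVar d))
    (ω : Restriction d) (f : ι → MvPolynomial (IMMVar d) K) (U : ι → Finset (IMMVar d))
    (hsub : ∀ i, U i ⊆ V) (hcover : V ⊆ Finset.univ.biUnion U)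
    (hvars : ∀ i, ∀ x ∈ (f i).vars, x ∈ V → x ∈ U i)
    (hdisj : ∀ i j, i ≠ j → Disjoint (U i) (U j)) :
    relRank V ω (∏ i, f i) ≤ ∏ i, relRank (U i) ω (f i) := by
  have heval : restrictedEval V ω (∏ i, f i) =
      fun a b => ∏ i, restrictedEval (U i) ω (f i) a b := by
    ext a b
    calc restrictedEval V ω (∏ i, f i) a b = ∏ i, restrictedEval V ω (f i) a b := by
          simp [restrictedEval, map_prod]
      _ = _ := Finset.prod_congr rfl fun i _ => by rw [restrictedEval_congr (hsub i) (hvars i)]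
  have hact : (activeVars V ω).card = ∑ i, (activeVars (U i) ω).card := by
    rw [← Finset.card_biUnion]
    · congr 1
      ext x
      simp only [activeVars, Finset.mem_filter, Finset.mem_biUnion, Finset.mem_univ, true_and]
      constructor
      · rintro ⟨hx, hs⟩
        obtain ⟨i, -, hi⟩ := Finset.mem_biUnion.1 (hcover hx)
        exact ⟨i, hi, hs⟩
      · rintro ⟨i, hi, hs⟩
        exact ⟨hsub i hi, hs⟩
    · intro i _ j _ hij
      exact (hdisj i j hij).mono (Finset.filter_subset _ _) (Finset.filter_subset _ _)
  unfold relRank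
  rw [Finset.prod_mul_distrib, Finset.prod_pow_eq_pow_sum, hact, heval]
  refine mul_le_mul_of_nonneg_right ?_ (pow_nonneg invSqrtTwo_pos.le _)
  exact_mod_cast functionRank_prod_le Finset.univ fun i => restrictedEval (U i) ω (f i)

/-- A polynomial that is affine as a function. -/
def IsAffineFunction {X : Type*} [Fintype X] (f : MvPolynomial X K) : Prop :=
  ∃ (c : K) (l : X → K), ∀ P, MvPolynomial.eval P f = c + ∑ x, l x * P x

/-- No variable depends on both arguments, so an affine function becomes a function of `a` plus a
function of `b`. Constants are counted with `a`. -/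
lemma functionRank_restrictedEval_le_two {f : MvPolynomial (IMMVar d) K} (hf : IsAffineFunction f)
    (V : Finset (IMMVar d)) (ω : Restriction d) : functionRank (restrictedEval V ω f) ≤ 2 := by
  obtain ⟨c, l, hcl⟩ := hf
  refine HasRankLE.functionRank_le ⟨![fun a => c + ∑ x, if x ∈ negVars V ω then 0 else
      l x * restrictedPoint K V ω a (fun _ => false) x, fun _ => 1],
    ![fun _ => 1, fun b => ∑ x, if x ∈ negVars V ω then
      l x * restrictedPoint K V ω (fun _ => false) b x else 0], fun a b => ?_⟩
  simp only [restrictedEval, hcl, Fin.sum_univ_two, Matrix.cons_val_zero, Matrix.cons_val_one,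
    mul_one, one_mul]
  rw [add_assoc, ← Finset.sum_add_distrib]
  congr 1
  refine Finset.sum_congr rfl fun x _ => ?_
  split_ifs with hx
  · rw [zero_add]
    have hx' := (Finset.mem_filter.1 hx).2
    simp [restrictedPoint, restrictedValue, hx']
  · rw [add_zero]
    have hx' : x ∈ V → varSign ω x ≠ -1 := fun hV h => hx (Finset.mem_filter.2 ⟨hV, h⟩)
    by_cases hV : x ∈ V
    · simp [restrictedPoint, restrictedValue, hV, hx' hV]
    · simp [restrictedPoint, hV]

lemma exists_disjoint_chunks {X : Type*} [DecidableEq X] (m : ℕ) (hm : 0 < m) (n : ℕ) :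
    ∀ V : Finset X, m * n ≤ V.card → ∃ 𝓒 : Finset (Finset X), 𝓒.card = n ∧
      (∀ U ∈ 𝓒, U ⊆ V ∧ U.card = m) ∧ ∀ U ∈ 𝓒, ∀ U' ∈ 𝓒, U ≠ U' → Disjoint U U' := by
  induction n with
  | zero => exact fun V _ => ⟨∅, by simp, by simp, by simp⟩
  | succ n ih =>
    intro V hV
    rw [Nat.mul_succ] at hV
    obtain ⟨U, hUV, hU⟩ := Finset.exists_subset_card_eq (s := V) (n := m) (by omega)
    obtain ⟨𝓒, h1, h2, h3⟩ := ih (V \ U) (by rw [Finset.card_sdiff_of_subset hUV]; omega)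
    have hdU : ∀ U' ∈ 𝓒, Disjoint U U' := fun U' hU' =>
      Finset.disjoint_sdiff.mono_right (h2 U' hU').1
    have hnot : U ∉ 𝓒 := by
      intro h
      have := hdU U h
      rw [disjoint_self, Finset.bot_eq_empty] at this
      rw [this] at hU
      simp at hU
      omega
    refine ⟨insert U 𝓒, by rw [Finset.card_insert_of_notMem hnot, h1], ?_, ?_⟩
    · intro U' hU'
      rcases Finset.mem_insert.1 hU' with rfl | h
      · exact ⟨hUV, hU⟩
      · exact ⟨(h2 U' h).1.trans Finset.sdiff_subset, (h2 U' h).2⟩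
    · intro A hA B hB hAB
      rcases Finset.mem_insert.1 hA with rfl | hA' <;> rcases Finset.mem_insert.1 hB with rfl | hB'
      · exact absurd rfl hAB
      · exact hdU B hB'
      · exact (hdU A hA').symm
      · exact h3 A hA' B hB' hAB

/-- A family of factors: pairwise disjoint nonempty sets of variables, those with the flag `true`
having at least 25 elements, all of them contained in `V`. -/
structure IsFactorFamily (V : Finset (IMMVar d)) (𝓕 : Finset (Finset (IMMVar d) × Bool)) :
    Prop where
  subset : ∀ p ∈ 𝓕, p.1 ⊆ V
  nonempty : ∀ p ∈ 𝓕, p.1.Nonempty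
  large : ∀ p ∈ 𝓕, p.2 = true → 25 ≤ p.1.card
  disjoint : ∀ p ∈ 𝓕, ∀ q ∈ 𝓕, p ≠ q → Disjoint p.1 q.1

/-- The product of the weights of a family of factors. -/
noncomputable def familyWeight (𝓕 : Finset (Finset (IMMVar d) × Bool)) (ω : Restriction d) : ℝ :=
  ∏ p ∈ 𝓕, eventWeight (FactorEvent p ω)

lemma familyWeight_nonneg (𝓕 : Finset (Finset (IMMVar d) × Bool)) (ω : Restriction d) :
    0 ≤ familyWeight 𝓕 ω := Finset.prod_nonneg fun _ _ => (eventWeight_pos _).le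

lemma isFactorFamily_singleton {V : Finset (IMMVar d)} (hV : V.Nonempty) :
    IsFactorFamily V {(V, false)} :=
  ⟨by simp, by simpa using hV, by simp, by simp⟩

lemma IsFactorFamily.mono {V V' : Finset (IMMVar d)} {𝓕 : Finset (Finset (IMMVar d) × Bool)}
    (h : IsFactorFamily V 𝓕) (hV : V ⊆ V') : IsFactorFamily V' 𝓕 :=
  ⟨fun p hp => (h.subset p hp).trans hV, h.nonempty, h.large, h.disjoint⟩

lemma IsFactorFamily.disjoint_families {V V' : Finset (IMMVar d)}
    {𝓕 𝓕' : Finset (Finset (IMMVar d) × Bool)} (h : IsFactorFamily V 𝓕)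
    (h' : IsFactorFamily V' 𝓕') (hV : Disjoint V V') : Disjoint 𝓕 𝓕' := by
  refine Finset.disjoint_left.2 fun p hp hp' => ?_
  obtain ⟨x, hx⟩ := h.nonempty p hp
  exact Finset.disjoint_left.1 hV (h.subset p hp hx) (h'.subset p hp' hx)

lemma IsFactorFamily.union {V V' : Finset (IMMVar d)}
    {𝓕 𝓕' : Finset (Finset (IMMVar d) × Bool)} (h : IsFactorFamily V 𝓕)
    (h' : IsFactorFamily V' 𝓕') (hV : Disjoint V V') :
    IsFactorFamily (V ∪ V') (𝓕 ∪ 𝓕') ∧ (𝓕 ∪ 𝓕').card = 𝓕.card + 𝓕'.card ∧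
      ∀ ω, familyWeight (𝓕 ∪ 𝓕') ω = familyWeight 𝓕 ω * familyWeight 𝓕' ω := by
  have hd := h.disjoint_families h' hV
  refine ⟨⟨?_, ?_, ?_, ?_⟩, Finset.card_union_of_disjoint hd, fun ω => Finset.prod_union hd⟩
  · intro p hp
    rcases Finset.mem_union.1 hp with hp | hp
    · exact (h.subset p hp).trans Finset.subset_union_left
    · exact (h'.subset p hp).trans Finset.subset_union_right
  · intro p hp
    rcases Finset.mem_union.1 hp with hp | hp
    · exact h.nonempty p hp
    · exact h'.nonempty p hp
  · intro p hp
    rcases Finset.mem_union.1 hp with hp | hp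
    · exact h.large p hp
    · exact h'.large p hp
  · intro p hp q hq hpq
    rcases Finset.mem_union.1 hp with hp | hp <;> rcases Finset.mem_union.1 hq with hq | hq
    · exact h.disjoint p hp q hq hpq
    · exact hV.mono (h.subset p hp) (h'.subset q hq)
    · exact (hV.mono (h.subset q hq) (h'.subset p hp)).symm
    · exact h'.disjoint p hp q hq hpq

/-- Families of factors on the members of a family of pairwise disjoint sets can be joined. -/
lemma exists_family_biUnion {ι : Type*} [DecidableEq ι] (s : Finset ι)
    (U : ι → Finset (IMMVar d)) (𝓕 : ι → Finset (Finset (IMMVar d) × Bool))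
    (h : ∀ i ∈ s, IsFactorFamily (U i) (𝓕 i)) (hdisj : ∀ i j, i ≠ j → Disjoint (U i) (U j)) :
    ∃ 𝓖, IsFactorFamily (s.biUnion U) 𝓖 ∧ 𝓖.card = ∑ i ∈ s, (𝓕 i).card ∧
      ∀ ω, familyWeight 𝓖 ω = ∏ i ∈ s, familyWeight (𝓕 i) ω := by
  induction s using Finset.induction_on with
  | empty => exact ⟨∅, ⟨by simp, by simp, by simp, by simp⟩, by simp, by simp [familyWeight]⟩
  | insert i s hi ih =>
    obtain ⟨𝓖, h1, h2, h3⟩ := ih fun j hj => h j (Finset.mem_insert_of_mem hj)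
    have hd : Disjoint (U i) (s.biUnion U) := by
      rw [Finset.disjoint_biUnion_right]
      intro j hj
      exact hdisj i j fun he => hi (he ▸ hj)
    obtain ⟨h4, h5, h6⟩ := (h i (Finset.mem_insert_self _ _)).union h1 hd
    refine ⟨𝓕 i ∪ 𝓖, by rwa [Finset.biUnion_insert], ?_, fun ω => ?_⟩
    · rw [h5, h2, Finset.sum_insert hi]
    · rw [h6, h3, Finset.prod_insert hi]

lemma prod_eventWeight_eq {I : Type*} (𝓕 : Finset I) (P : I → Prop) [DecidablePred P] :
    ∏ p ∈ 𝓕, eventWeight (P p) = invSqrtTwo ^ (𝓕.filter P).card := by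
  have : ∀ p ∈ 𝓕, eventWeight (P p) = if P p then invSqrtTwo else 1 := by
    intro p _
    unfold eventWeight
    split_ifs <;> rfl
  rw [Finset.prod_congr rfl this, Finset.prod_ite]
  simp

/-- Affine polynomials have small relative rank. -/
theorem exists_family_affine {V : Finset (IMMVar d)} (hV : V.Nonempty) :
    ∃ 𝓕, IsFactorFamily V 𝓕 ∧ V.card ≤ 50 * 𝓕.card ∧
      ∀ f : MvPolynomial (IMMVar d) K, IsAffineFunction f →
        ∀ ω, relRank V ω f ≤ familyWeight 𝓕 ω := by
  classical
  -- For small `V` a single balance event suffices; otherwise `V` is cut into chunks of 25, the size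
  -- needed to force three active variables.
  by_cases h50 : V.card ≤ 50
  · refine ⟨{(V, false)}, isFactorFamily_singleton hV, by simpa using h50, fun f _ ω => ?_⟩
    simpa [familyWeight] using relRank_le_eventWeight V ω f
  obtain ⟨𝓒, h1, h2, h3⟩ := exists_disjoint_chunks 25 (by norm_num) (V.card / 25) V (by omega)
  have hinj : Function.Injective fun U : Finset (IMMVar d) => (U, true) := fun _ _ h => by
    simpa using h
  refine ⟨𝓒.image fun U => (U, true), ⟨?_, ?_, ?_, ?_⟩, ?_, fun f hf ω => ?_⟩
  · intro p hp
    obtain ⟨U, hU, rfl⟩ := Finset.mem_image.1 hp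
    exact (h2 U hU).1
  · intro p hp
    obtain ⟨U, hU, rfl⟩ := Finset.mem_image.1 hp
    exact Finset.card_pos.1 (by rw [(h2 U hU).2]; norm_num)
  · intro p hp _
    obtain ⟨U, hU, rfl⟩ := Finset.mem_image.1 hp
    exact (h2 U hU).2.ge
  · intro p hp q hq hpq
    obtain ⟨U, hU, rfl⟩ := Finset.mem_image.1 hp
    obtain ⟨U', hU', rfl⟩ := Finset.mem_image.1 hq
    exact h3 U hU U' hU' fun h => hpq (by rw [h])
  · rw [Finset.card_image_of_injective _ hinj, h1]
    omega
  · rw [familyWeight, Finset.prod_image hinj.injOn,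
      prod_eventWeight_eq 𝓒 fun U => FactorEvent (U, true) ω]
    set q := (𝓒.filter fun U => FactorEvent (U, true) ω).card with hq
    have hact : 3 * q ≤ (activeVars V ω).card := by
      have hle : (𝓒.filter fun U => FactorEvent (U, true) ω).card * 3 ≤
          ∑ U ∈ 𝓒.filter fun U => FactorEvent (U, true) ω, (activeVars U ω).card := by
        rw [← smul_eq_mul]
        refine Finset.card_nsmul_le_sum _ _ _ fun U hU => ?_
        simpa [FactorEvent] using (Finset.mem_filter.1 hU).2
      rw [← Finset.card_biUnion] at hle
      · rw [mul_comm]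
        refine hle.trans (Finset.card_le_card ?_)
        intro x hx
        obtain ⟨U, hU, hx⟩ := Finset.mem_biUnion.1 hx
        exact Finset.filter_subset_filter _ (h2 U (Finset.mem_filter.1 hU).1).1 hx
      · intro U hU U' hU' hne
        exact (h3 U (Finset.mem_filter.1 hU).1 U' (Finset.mem_filter.1 hU').1 hne).mono
          (Finset.filter_subset _ _) (Finset.filter_subset _ _)
    rcases Nat.eq_zero_or_pos q with h0 | h0
    · rw [h0, pow_zero]
      exact relRank_le_one V ω f
    · have hr : (functionRank (restrictedEval V ω f) : ℝ) ≤ 2 := by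
        exact_mod_cast functionRank_restrictedEval_le_two hf V ω
      calc relRank V ω f ≤ 2 * invSqrtTwo ^ (activeVars V ω).card :=
            mul_le_mul_of_nonneg_right hr (pow_nonneg invSqrtTwo_pos.le _)
        -- As `3 * q ≥ q + 2` for `q ≥ 1`, two of the spare factors `invSqrtTwo` absorb the rank
        -- bound 2.
        _ ≤ 2 * invSqrtTwo ^ (q + 2) := by
            refine mul_le_mul_of_nonneg_left ?_ (by norm_num)
            exact pow_le_pow_of_le_one invSqrtTwo_pos.le invSqrtTwo_lt_one.le (by omega)
        _ = invSqrtTwo ^ q := by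
            rw [pow_add, sq, invSqrtTwo_mul_self]
            ring

end RelativeRank

/-! ### The iterated product has full relative rank and is not affine -/

section IteratedProduct

variable {d : ℕ} {K : Type*} [Field K]

/-- The first row of the product of the first `j` matrices. -/
def partialRow (A : Fin d → Matrix (Fin 2) (Fin 2) K) (j : ℕ) : Fin 2 → K :=
  ((List.ofFn A).take j).prod 0

lemma partialRow_zero (A : Fin d → Matrix (Fin 2) (Fin 2) K) (l : Fin 2) :
    partialRow A 0 l = if l = 0 then 1 else 0 := by
  fin_cases l <;> simp [partialRow]

lemma partialRow_succ (A : Fin d → Matrix (Fin 2) (Fin 2) K) {j : ℕ} (h : j < d) (l : Fin 2) :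
    partialRow A (j + 1) l = partialRow A j 0 * A ⟨j, h⟩ 0 l + partialRow A j 1 * A ⟨j, h⟩ 1 l := by
  unfold partialRow
  rw [List.prod_take_succ _ _ (by simpa using h), Matrix.mul_apply, Fin.sum_univ_two]
  simp

lemma eval_IMM (P : IMMVar d → K) :
    MvPolynomial.eval P (IMM K d) =
      partialRow (fun i => Matrix.of fun j k => P (i, j, k)) d 0 +
        partialRow (fun i => Matrix.of fun j k => P (i, j, k)) d 1 := by
  have h : (MvPolynomial.eval P).mapMatrix (List.ofFn (immMatrix K d)).prod =
      (List.ofFn fun i => (Matrix.of fun j k => P (i, j, k) : Matrix (Fin 2) (Fin 2) K)).prod := by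
    rw [map_list_prod, List.map_ofFn]
    congr 2
    funext i
    ext j k
    simp [immMatrix]
  have h' : ∀ j k, MvPolynomial.eval P ((List.ofFn (immMatrix K d)).prod j k) =
      (List.ofFn fun i => (Matrix.of fun j k => P (i, j, k) : Matrix (Fin 2) (Fin 2) K)).prod
        j k := by
    intro j k
    rw [← h]
    rfl
  have htake : ∀ A : Fin d → Matrix (Fin 2) (Fin 2) K, (List.ofFn A).take d = List.ofFn A :=
    fun A => List.take_of_length_le (by simp)
  rw [IMM, map_add, h', h', partialRow, htake]

/-- Whether the variable of the first kind that is pending before the `j`-th matrix lies in `U`. -/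
def PendingIn (U : Finset (IMMVar d)) (ω : Restriction d) : ℕ → Prop
  | 0 => False
  | j + 1 =>
    if (pathState ω j).1 = false ∧ (pathState ω (j + 1)).1 = true then
      ∃ h : j < d, ((⟨j, h⟩, (pathState ω j).2, (pathState ω (j + 1)).2) : IMMVar d) ∈ U
    else PendingIn U ω j

open Classical in
/-- The values of the variables of the second kind that test for inclusion in `T`. -/
noncomputable def testPoint (T : Finset (IMMVar d)) (ω : Restriction d) (x : IMMVar d) : Bool :=
  decide (PendingIn T ω x.1)

/-- The elements of `S` that belong to the first `j` matrices lie in `T`. -/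
def InclusionBelow (S T : Finset (IMMVar d)) (j : ℕ) : Prop := ∀ x ∈ S, x.1.val < j → x ∈ T

/-- A variable of the first kind occurs only where the pending bit turns on, so otherwise matrix `j`
contributes nothing to `S`. -/
lemma inclusionBelow_succ_of_not_flip {S T : Finset (IMMVar d)} {ω : Restriction d}
    (hS : S ⊆ posVars Finset.univ ω) {j : ℕ}
    (h : ¬ ((pathState ω j).1 = false ∧ (pathState ω (j + 1)).1 = true)) :
    InclusionBelow S T (j + 1) ↔ InclusionBelow S T j := by
  refine ⟨fun H x hx hj => H x hx (by omega), fun H x hx hj => ?_⟩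
  rcases Nat.lt_succ_iff_lt_or_eq.1 hj with hj | hj
  · exact H x hx hj
  · exfalso
    have hs := (Finset.mem_filter.1 (hS hx)).2
    unfold varSign at hs
    rw [hj] at hs
    split_ifs at hs
    · revert hs h
      cases (pathState ω j).1 <;> cases (pathState ω (j + 1)).1 <;> simp
    · exact absurd hs (by norm_num)

/-- The only entry of matrix `j` that can lie in `S` is the one on the path. -/
lemma inclusionBelow_succ_of_flip {S T : Finset (IMMVar d)} {ω : Restriction d}
    (hS : S ⊆ posVars Finset.univ ω) {j : ℕ} (hj : j < d) :
    InclusionBelow S T (j + 1) ↔ InclusionBelow S T j ∧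
      (((⟨j, hj⟩, (pathState ω j).2, (pathState ω (j + 1)).2) : IMMVar d) ∈ S →
        ((⟨j, hj⟩, (pathState ω j).2, (pathState ω (j + 1)).2) : IMMVar d) ∈ T) := by
  refine ⟨fun H => ⟨fun x hx hj => H x hx (by omega), fun h => H _ h (Nat.lt_succ_self j)⟩,
    fun H x hx hj' => ?_⟩
  rcases Nat.lt_succ_iff_lt_or_eq.1 hj' with hj' | hj'
  · exact H.1 x hx hj'
  · have hs := (Finset.mem_filter.1 (hS hx)).2
    unfold varSign at hs
    rw [hj'] at hs
    split_ifs at hs with hk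
    swap
    · exact absurd hs (by norm_num)
    have hxe : x = (⟨j, hj⟩, (pathState ω j).2, (pathState ω (j + 1)).2) := by
      obtain ⟨i, k, k'⟩ := x
      have : i = ⟨j, hj⟩ := Fin.ext hj'
      rw [this, hk.1, hk.2]
    rw [hxe] at hx ⊢
    exact H.2 hx

-- The invariant of the path. With nothing pending, the row vector is the path's unit vector times
-- the truth value of the inclusion so far. While a variable is pending, the row holds its value in
-- the path's coordinate and `1` in the other, multiplied by the truth value `D` of the inclusion
-- for the earlier variables.
open Classical in
lemma partialRow_restricted {S T : Finset (IMMVar d)} {ω : Restriction d}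
    (hS : S ⊆ posVars Finset.univ ω) (A : Fin d → Matrix (Fin 2) (Fin 2) K)
    (hA : ∀ i k k', A i k k' =
      restrictedValue K ω (fun x => decide (x ∈ S)) (testPoint T ω) (i, k, k'))
    (j : ℕ) (hj : j ≤ d) :
    ((pathState ω j).1 = false → ∀ l, partialRow A j l =
      if l = (pathState ω j).2 ∧ InclusionBelow S T j then 1 else 0) ∧
    ((pathState ω j).1 = true → ∃ D : Prop,
      (InclusionBelow S T j ↔ D ∧ (PendingIn S ω j → PendingIn T ω j)) ∧
      ∀ l, partialRow A j l =
        if D then (if l = (pathState ω j).2 then (if PendingIn S ω j then 1 else 0) else 1)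
        else 0) := by
  have htest : ∀ x, testPoint T ω x = true ↔ PendingIn T ω x.1 := fun x => by simp [testPoint]
  induction j with
  | zero =>
    have h0 : pathState ω 0 = (false, 0) := by simp [pathState]
    simp only [h0, partialRow_zero]
    refine ⟨fun _ l => ?_, fun h => by simp at h⟩
    have : InclusionBelow S T 0 := fun x _ h => absurd h (Nat.not_lt_zero _)
    simp [this]
  | succ j ih =>
    have hjd : j < d := hj
    obtain ⟨ih0, ih1⟩ := ih (by omega)
    have hflip := inclusionBelow_succ_of_flip (T := T) hS hjd
    have hnot := inclusionBelow_succ_of_not_flip (S := S) (T := T) (ω := ω) hS (j := j)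
    have hpS : PendingIn S ω (j + 1) = if (pathState ω j).1 = false ∧
      (pathState ω (j + 1)).1 = true then
      ∃ h : j < d, ((⟨j, h⟩, (pathState ω j).2, (pathState ω (j + 1)).2) : IMMVar d) ∈ S
      else PendingIn S ω j := rfl
    have hpT : PendingIn T ω (j + 1) = if (pathState ω j).1 = false ∧
      (pathState ω (j + 1)).1 = true then
      ∃ h : j < d, ((⟨j, h⟩, (pathState ω j).2, (pathState ω (j + 1)).2) : IMMVar d) ∈ T
      else PendingIn T ω j := rfl
    simp only [partialRow_succ _ hjd]
    simp only [hA, restrictedValue, varSign, htest, constEntry, decide_eq_true_eq]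
    obtain ⟨⟨b, k⟩, hs⟩ : ∃ s, pathState ω j = s := ⟨_, rfl⟩
    obtain ⟨⟨b', k'⟩, hs'⟩ : ∃ s, pathState ω (j + 1) = s := ⟨_, rfl⟩
    simp only [hs, hs'] at ih0 ih1 hflip hnot hpS hpT ⊢
    cases b <;> cases b'
    · have ih0 := ih0 rfl
      have hnot := hnot (by simp)
      refine ⟨fun _ l => ?_, by simp⟩
      rw [ih0, ih0, hnot]
      fin_cases k <;> fin_cases k' <;> fin_cases l <;> simp
    · have ih0 := ih0 rfl
      refine ⟨by simp, fun _ => ⟨InclusionBelow S T j, ?_, fun l => ?_⟩⟩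
      · rw [hflip, hpS, hpT]
        simp [hjd]
      · rw [ih0, ih0, hpS]
        by_cases hI : InclusionBelow S T j <;>
        fin_cases k <;> fin_cases k' <;> fin_cases l <;> simp [hI, hjd]
    -- The pending period ends. With `s` and `t` the membership of the pending variable in `S` and
    -- `T`, the variable of the second kind has value `t - 1`, and the new entry `1 + s * (t - 1)`
    -- is the truth value of `s → t`.
    · obtain ⟨D, hD, ih1⟩ := ih1 rfl
      have hnot := hnot (by simp)
      refine ⟨fun _ l => ?_, by simp⟩
      rw [ih1, ih1, hnot, hD]
      by_cases h1 : D <;> by_cases h2 : PendingIn S ω j <;> by_cases h3 : PendingIn T ω j <;>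
        fin_cases k <;> fin_cases k' <;> fin_cases l <;> simp [h1, h2, h3]
    · obtain ⟨D, hD, ih1⟩ := ih1 rfl
      have hnot := hnot (by simp)
      refine ⟨by simp, fun _ => ⟨D, ?_, fun l => ?_⟩⟩
      · rw [hnot, hD, hpS, hpT]
        simp
      · rw [ih1, ih1, hpS]
        by_cases h1 : D <;> by_cases h2 : PendingIn S ω j <;>
          fin_cases k <;> fin_cases k' <;> fin_cases l <;> simp [h1, h2]

theorem two_pow_le_functionRank_IMM (ω : Restriction d) :
    2 ^ (posVars Finset.univ ω).card ≤
      functionRank (restrictedEval Finset.univ ω (IMM K d)) := by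
  classical
  refine two_pow_card_le_functionRank (posVars Finset.univ ω) _
    (fun S x => decide (x ∈ S)) (fun T => testPoint T ω) fun S hS T hT => ?_
  have hd : pathState ω d = (false, 0) := by simp [pathState]
  have h := (partialRow_restricted (K := K) (T := T) hS
    (fun i => Matrix.of fun k k' => restrictedValue K ω (fun x => decide (x ∈ S)) (testPoint T ω)
      (i, k, k')) (fun _ _ _ => rfl) d le_rfl).1 (by rw [hd])
  have hI : InclusionBelow S T d ↔ S ⊆ T :=
    ⟨fun H x hx => H x hx x.1.2, fun H x hx _ => H hx⟩
  have hP : restrictedPoint K Finset.univ ω (fun x => decide (x ∈ S)) (testPoint T ω) =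
      restrictedValue K ω (fun x => decide (x ∈ S)) (testPoint T ω) := by
    ext x; simp [restrictedPoint]
  rw [restrictedEval, eval_IMM, hP, h, h, hd]
  simp [hI]

/-- The signs along the path telescope, and nothing is pending at either end. -/
lemma card_posVars_univ (ω : Restriction d) :
    (posVars Finset.univ ω).card = (negVars Finset.univ ω).card := by
  have h := card_posVars_sub_card_negVars Finset.univ ω
  have hi : ∀ i : Fin d, ∑ p : Fin 2 × Fin 2, varSign ω (i, p) =
      (pathState ω (i.val + 1)).1.toInt - (pathState ω i.val).1.toInt := by
    intro i
    rw [Finset.sum_eq_single ((pathState ω i.val).2, (pathState ω (i.val + 1)).2)]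
    · simp [varSign]
    · intro p _ hp
      unfold varSign
      rw [if_neg]
      rintro ⟨h1, h2⟩
      exact hp (Prod.ext h1.symm h2.symm)
    · simp
  rw [Fintype.sum_prod_type, Finset.sum_congr rfl fun i _ => hi i,
    Fin.sum_univ_eq_sum_range
      (fun i => (pathState ω (i + 1)).1.toInt - (pathState ω i).1.toInt) d,
    Finset.sum_range_sub fun i => (pathState ω i).1.toInt] at h
  have h0 : pathState ω 0 = (false, 0) := by simp [pathState]
  have hd : pathState ω d = (false, 0) := by simp [pathState]
  rw [h0, hd] at h
  omega

theorem one_le_relRank_IMM (ω : Restriction d) : 1 ≤ relRank Finset.univ ω (IMM K d) := by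
  unfold relRank
  rw [card_activeVars, ← card_posVars_univ, ← two_pow_mul_invSqrtTwo_pow]
  refine mul_le_mul_of_nonneg_right ?_ (pow_nonneg invSqrtTwo_pos.le _)
  exact_mod_cast two_pow_le_functionRank_IMM (K := K) ω

/-- The polynomial is not an affine function if there are at least two matrices. -/
theorem not_isAffineFunction_IMM (hd : 2 ≤ d) : ¬ IsAffineFunction (IMM K d) := by
  rintro ⟨c, l, h⟩
  have hzero : ∀ (P : IMMVar d → K) (i : ℕ) (hi : i < d),
      (∀ j k, P (⟨i, hi⟩, j, k) = 0) → MvPolynomial.eval P (IMM K d) = 0 := by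
    intro P i hi hP
    have hrow : ∀ n, i + 1 + n ≤ d →
        partialRow (fun i => Matrix.of fun j k => P (i, j, k)) (i + 1 + n) = 0 := by
      intro n
      induction n with
      | zero =>
        intro _
        ext k
        rw [add_zero, partialRow_succ _ hi]
        simp [hP]
      | succ n ih =>
        intro hn
        ext k
        rw [← add_assoc, partialRow_succ _ (by omega), ih (by omega)]
        simp
    have := hrow (d - (i + 1)) (by omega)
    rw [Nat.add_sub_of_le (by omega)] at this
    rw [eval_IMM, this]
    simp
  have hone : MvPolynomial.eval (fun x : IMMVar d => if x.2 = (0, 0) then (1 : K) else 0)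
      (IMM K d) = 1 := by
    have hrow : ∀ n, n ≤ d → partialRow (fun i : Fin d => Matrix.of fun j k =>
        (fun x : IMMVar d => if x.2 = (0, 0) then (1 : K) else 0) (i, j, k)) n = ![1, 0] := by
      intro n
      induction n with
      | zero =>
        intro _
        ext k
        rw [partialRow_zero]
        fin_cases k <;> simp
      | succ n ih =>
        intro hn
        ext k
        rw [partialRow_succ _ (by omega), ih (by omega)]
        fin_cases k <;> simp
    rw [eval_IMM, hrow d le_rfl]
    simp
  -- An affine function vanishing at the origin is additive. The all-`(0, 0)` point is the sum of a
  -- point that kills the first matrix and one that kills the second, so its value `1` would be `0 +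
  -- 0`.
  have h0 := hzero 0 0 (by omega) (by simp)
  have h1 := hzero (fun x => if x.1.val = 0 then 0 else if x.2 = (0, 0) then (1 : K) else 0) 0
    (by omega) (by simp)
  have h2 := hzero (fun x => if x.1.val = 0 then if x.2 = (0, 0) then (1 : K) else 0 else 0) 1
    (by omega) (by simp)
  rw [h] at h0 h1 h2 hone
  have hsum : ∑ x : IMMVar d, l x * (if x.2 = (0, 0) then (1 : K) else 0) =
      ∑ x : IMMVar d, l x *
        (if x.1.val = 0 then 0 else if x.2 = (0, 0) then (1 : K) else 0) +
      ∑ x : IMMVar d, l x *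
        (if x.1.val = 0 then if x.2 = (0, 0) then (1 : K) else 0 else 0) := by
    rw [← Finset.sum_add_distrib]
    refine Finset.sum_congr rfl fun x _ => ?_
    split_ifs <;> simp
  simp only [Pi.zero_apply, mul_zero, Finset.sum_const_zero, add_zero] at h0
  rw [h0, zero_add] at h1 h2 hone
  rw [hsum, h1, h2, add_zero] at hone
  exact zero_ne_one hone

end IteratedProduct

/-! ### Induction on formulas -/

section FormulaInduction

/-- The number of factors, up to a constant, into which the terms of a formula of product-depth `Δ`
in `N` variables can be split. -/
noncomputable def depthExponent (Δ N : ℕ) : ℝ := Δ * ((N : ℝ) ^ (1 / (Δ : ℝ)) - 1) / 50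

/-- This is Bernoulli's inequality for the `Δ`-th root of `N`. -/
lemma depthExponent_le {Δ : ℕ} (hΔ : 1 ≤ Δ) (N : ℕ) : depthExponent Δ N ≤ N / 50 := by
  have h0 : (0 : ℝ) ≤ (N : ℝ) ^ (1 / (Δ : ℝ)) := Real.rpow_nonneg (Nat.cast_nonneg _) _
  have h := one_add_mul_sub_le_pow (a := (N : ℝ) ^ (1 / (Δ : ℝ))) (by linarith) Δ
  rw [one_div, Real.rpow_inv_natCast_pow (Nat.cast_nonneg _) (by omega)] at h
  unfold depthExponent
  rw [one_div]
  linarith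

/-- Weighted AM-GM with weights `1 / (Δ + 1)` and `Δ / (Δ + 1)`, applied to `m` and the `Δ`-th root
of `N'`. It balances the gain from `m - 1` siblings against the gain from the largest child. -/
lemma depthExponent_succ_le {Δ m N N' : ℕ} (hΔ : 1 ≤ Δ) (hm : 1 ≤ m) (h : N ≤ m * N') :
    depthExponent (Δ + 1) N ≤ (m - 1) + depthExponent Δ N' := by
  have hD : (0 : ℝ) < Δ := by exact_mod_cast hΔ
  have hm' : (1 : ℝ) ≤ m := by exact_mod_cast hm
  have hN' : (0 : ℝ) ≤ N' := Nat.cast_nonneg _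
  set u : ℝ := (N' : ℝ) ^ (1 / (Δ : ℝ)) with hu
  have hu0 : 0 ≤ u := Real.rpow_nonneg hN' _
  have hamgm := Real.geom_mean_le_arith_mean2_weighted (w₁ := 1 / ((Δ : ℝ) + 1))
    (w₂ := Δ / ((Δ : ℝ) + 1)) (p₁ := m) (p₂ := u) (by positivity) (by positivity)
    (by positivity) hu0 (by field_simp; ring)
  have hpow : u ^ ((Δ : ℝ) / (Δ + 1)) = (N' : ℝ) ^ (1 / ((Δ : ℝ) + 1)) := by
    rw [hu, ← Real.rpow_mul hN']
    congr 1
    field_simp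
  rw [hpow, ← Real.mul_rpow (by positivity) hN'] at hamgm
  have hle : (N : ℝ) ^ (1 / ((Δ : ℝ) + 1)) ≤ ((m : ℝ) * N') ^ (1 / ((Δ : ℝ) + 1)) :=
    Real.rpow_le_rpow (Nat.cast_nonneg _) (by exact_mod_cast h) (by positivity)
  have hfin : ((Δ : ℝ) + 1) * (N : ℝ) ^ (1 / ((Δ : ℝ) + 1)) ≤ m + Δ * u := by
    have h1 := mul_le_mul_of_nonneg_left (hle.trans hamgm) (by positivity : (0 : ℝ) ≤ Δ + 1)
    refine h1.trans_eq ?_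
    field_simp
  unfold depthExponent
  rw [← hu]
  push_cast
  nlinarith

lemma isAffineFunction_of_productDepth {X K : Type*} [Fintype X] [Field K]
    (Φ : ArithFormula K X) (h : Φ.productDepth = 0) : IsAffineFunction Φ.poly := by
  classical
  induction Φ with
  | var x =>
    exact ⟨0, fun y => if y = x then 1 else 0, fun P => by simp [ArithFormula.poly]⟩
  | const a => exact ⟨a, fun _ => 0, fun P => by simp [ArithFormula.poly]⟩
  | sum n w child ih =>
    have hc : ∀ i, (child i).productDepth = 0 := by
      intro i
      have : (child i).productDepth ≤ Finset.univ.sup fun i => (child i).productDepth :=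
        Finset.le_sup (f := fun i => (child i).productDepth) (Finset.mem_univ i)
      simp only [ArithFormula.productDepth] at h
      omega
    choose c l hcl using fun i => ih i (hc i)
    refine ⟨∑ i, w i * c i, fun x => ∑ i, w i * l i x, fun P => ?_⟩
    simp only [ArithFormula.poly, map_sum, map_mul, MvPolynomial.eval_C, hcl, mul_add,
      Finset.sum_add_distrib, Finset.sum_mul, Finset.mul_sum]
    rw [Finset.sum_comm (s := (Finset.univ : Finset X))]
    simp only [mul_assoc]
  | prod n child ih => simp [ArithFormula.productDepth] at h

/-- Degrees in each variable add up over a field when no factor vanishes. This is why semantic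
multilinearity suffices. -/
lemma disjoint_vars_of_isMultilinearPoly_prod {X K : Type*} [Field K] {n : ℕ}
    (f : Fin n → MvPolynomial X K) (h : IsMultilinearPoly (∏ i, f i)) (h0 : ∀ i, f i ≠ 0)
    (i j : Fin n) (hij : i ≠ j) : Disjoint (f i).vars (f j).vars := by
  refine Finset.disjoint_left.2 fun x hi hj => ?_
  have hx := h x
  rw [MvPolynomial.degreeOf_prod_eq _ _ fun i _ => h0 i] at hx
  have hi' := MvPolynomial.mem_vars_iff_degreeOf_ne_zero.1 hi
  have hj' := MvPolynomial.mem_vars_iff_degreeOf_ne_zero.1 hj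
  have := Finset.add_le_sum (f := fun i => (f i).degreeOf x) (fun _ _ => Nat.zero_le _)
    (Finset.mem_univ i) (Finset.mem_univ j) hij
  omega

/-- A partition of `V` along which a product of polynomials in disjoint sets of variables splits. -/
lemma exists_partition {X : Type*} [DecidableEq X] {n : ℕ} (hn : 0 < n) (W : Fin n → Finset X)
    (hW : ∀ i j, i ≠ j → Disjoint (W i) (W j)) (V : Finset X) :
    ∃ U : Fin n → Finset X, (∀ i, U i ⊆ V) ∧ V ⊆ Finset.univ.biUnion U ∧
      (∀ i, ∀ x ∈ W i, x ∈ V → x ∈ U i) ∧ ∀ i j, i ≠ j → Disjoint (U i) (U j) := by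
  classical
  -- Variables of `V` that occur in no factor are all given to the first part.
  set i0 : Fin n := ⟨0, hn⟩
  refine ⟨fun i => V.filter fun x => x ∈ W i ∨ (i = i0 ∧ ∀ j, x ∉ W j),
    fun i => Finset.filter_subset _ _, fun x hx => ?_, fun i x hx hV => ?_, fun i j hij => ?_⟩
  · by_cases h : ∃ j, x ∈ W j
    · obtain ⟨j, hj⟩ := h
      exact Finset.mem_biUnion.2 ⟨j, Finset.mem_univ _, Finset.mem_filter.2 ⟨hx, Or.inl hj⟩⟩
    · push Not at h
      exact Finset.mem_biUnion.2
        ⟨i0, Finset.mem_univ _, Finset.mem_filter.2 ⟨hx, Or.inr ⟨rfl, h⟩⟩⟩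
  · exact Finset.mem_filter.2 ⟨hV, Or.inl hx⟩
  · refine Finset.disjoint_left.2 fun x hi hj => ?_
    rcases (Finset.mem_filter.1 hi).2 with hi | hi <;>
      rcases (Finset.mem_filter.1 hj).2 with hj | hj
    · exact Finset.disjoint_left.1 (hW i j hij) hi hj
    · exact hj.2 i hi
    · exact hi.2 j hj
    · exact hij (hi.1.trans hj.1.symm)

lemma ArithFormula.one_le_size {R X : Type*} (Φ : ArithFormula R X) : 1 ≤ Φ.size := by
  cases Φ <;> simp [ArithFormula.size]

variable {d : ℕ} {K : Type*} [Field K]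

/-- The bound on the sum over all restrictions of a quantity bounded by the weights of `n` disjoint
factors. -/
noncomputable def decayBound (d : ℕ) (n : ℝ) : ℝ :=
  Real.exp (-(decayRate * (n - 16))) * Fintype.card (Restriction d)

lemma decayBound_nonneg (d : ℕ) (n : ℝ) : 0 ≤ decayBound d n :=
  mul_nonneg (Real.exp_pos _).le (Nat.cast_nonneg _)

lemma decayBound_anti (d : ℕ) {m n : ℝ} (h : m ≤ n) : decayBound d n ≤ decayBound d m := by
  refine mul_le_mul_of_nonneg_right (Real.exp_le_exp.2 ?_) (Nat.cast_nonneg _)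
  have := mul_le_mul_of_nonneg_left h decayRate_pos.le
  linarith

lemma sum_mul_familyWeight_le {U V : Finset (IMMVar d)}
    {𝓕 𝓖 : Finset (Finset (IMMVar d) × Bool)} (hF : IsFactorFamily U 𝓕) (hG : IsFactorFamily V 𝓖)
    (hUV : Disjoint U V) (r : Restriction d → ℝ) (hr : ∀ ω, r ω ≤ familyWeight 𝓖 ω) :
    ∑ ω, r ω * familyWeight 𝓕 ω ≤ decayBound d (𝓕.card + 𝓖.card) := by
  obtain ⟨h1, h2, h3⟩ := hF.union hG hUV
  have h := sum_prod_factorEvent_le (𝓕 ∪ 𝓖) h1.disjoint h1.nonempty h1.large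
  rw [h2] at h
  push_cast at h
  refine le_trans (Finset.sum_le_sum fun ω _ => ?_) h
  have := h3 ω
  unfold familyWeight at this hr ⊢
  rw [this, mul_comm]
  exact mul_le_mul_of_nonneg_left (hr ω) (familyWeight_nonneg 𝓕 ω)

lemma sum_relRank_affine_le {U V : Finset (IMMVar d)} {𝓕 : Finset (Finset (IMMVar d) × Bool)}
    (hF : IsFactorFamily U 𝓕) (hUV : Disjoint U V) (hV : V.Nonempty)
    {f : MvPolynomial (IMMVar d) K} (hf : IsAffineFunction f) {Δ : ℕ} (hΔ : 1 ≤ Δ) :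
    ∑ ω, relRank V ω f * familyWeight 𝓕 ω ≤
      decayBound d (𝓕.card + depthExponent Δ V.card) := by
  obtain ⟨𝓖, hG, hcard, hle⟩ := exists_family_affine (K := K) hV
  refine (sum_mul_familyWeight_le hF hG hUV _ (hle f hf)).trans (decayBound_anti d ?_)
  have h1 := depthExponent_le hΔ V.card
  have h2 : (V.card : ℝ) ≤ 50 * 𝓖.card := by exact_mod_cast hcard
  linarith

/-- The expected relative rank of a multilinear formula of bounded product-depth, weighted by
the weights of further factors in disjoint variables. -/
theorem sum_relRank_formula_le (Φ : ArithFormula K (IMMVar d)) :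
    ∀ (Δ : ℕ) (U V : Finset (IMMVar d)) (𝓕 : Finset (Finset (IMMVar d) × Bool)), 1 ≤ Δ →
      Φ.IsMultilinear → Φ.productDepth ≤ Δ → V.Nonempty → IsFactorFamily U 𝓕 → Disjoint U V →
      ∑ ω, relRank V ω Φ.poly * familyWeight 𝓕 ω ≤
        Φ.size * decayBound d (𝓕.card + depthExponent Δ V.card) := by
  classical
  -- Affine gates satisfy the bound for every `Δ ≥ 1`, since they split into `V.card / 50` factors
  -- at least.
  have haff : ∀ (Ψ : ArithFormula K (IMMVar d)) (Δ : ℕ) (U V : Finset (IMMVar d))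
      (𝓕 : Finset (Finset (IMMVar d) × Bool)), 1 ≤ Δ → V.Nonempty → IsFactorFamily U 𝓕 →
      Disjoint U V → IsAffineFunction Ψ.poly →
      ∑ ω, relRank V ω Ψ.poly * familyWeight 𝓕 ω ≤
        Ψ.size * decayBound d (𝓕.card + depthExponent Δ V.card) := by
    intro Ψ Δ U V 𝓕 hΔ hV hF hUV ha
    refine (sum_relRank_affine_le hF hUV hV ha hΔ).trans ?_
    refine le_mul_of_one_le_left (decayBound_nonneg _ _) ?_
    exact_mod_cast Ψ.one_le_size
  induction Φ with
  | var x =>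
    intro Δ U V 𝓕 hΔ _ _ hV hF hUV
    exact haff _ Δ U V 𝓕 hΔ hV hF hUV (isAffineFunction_of_productDepth _ rfl)
  | const a =>
    intro Δ U V 𝓕 hΔ _ _ hV hF hUV
    exact haff _ Δ U V 𝓕 hΔ hV hF hUV (isAffineFunction_of_productDepth _ rfl)
  | sum n w child ih =>
    intro Δ U V 𝓕 hΔ hml hdepth hV hF hUV
    have hc : ∀ i, (child i).productDepth ≤ Δ := fun i =>
      (Finset.le_sup (f := fun i => (child i).productDepth) (Finset.mem_univ i)).trans hdepth
    calc ∑ ω, relRank V ω (ArithFormula.sum n w child).poly * familyWeight 𝓕 ω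
        ≤ ∑ ω, (∑ i, relRank V ω (child i).poly) * familyWeight 𝓕 ω :=
          Finset.sum_le_sum fun ω _ => mul_le_mul_of_nonneg_right
            (relRank_sum_le V ω w fun i => (child i).poly) (familyWeight_nonneg _ _)
      _ = ∑ i, ∑ ω, relRank V ω (child i).poly * familyWeight 𝓕 ω := by
          simp_rw [Finset.sum_mul]
          exact Finset.sum_comm
      _ ≤ ∑ i, (child i).size * decayBound d (𝓕.card + depthExponent Δ V.card) :=
          Finset.sum_le_sum fun i _ => ih i Δ U V 𝓕 hΔ (hml.2 i) (hc i) hV hF hUV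
      _ = (∑ i, (child i).size : ℕ) * decayBound d (𝓕.card + depthExponent Δ V.card) := by
          push_cast
          rw [Finset.sum_mul]
      _ ≤ _ := by
          refine mul_le_mul_of_nonneg_right ?_ (decayBound_nonneg _ _)
          simp only [ArithFormula.size]
          push_cast
          linarith
  | prod n child ih =>
    intro Δ U V 𝓕 hΔ hml hdepth hV hF hUV
    rcases Nat.eq_zero_or_pos n with hn | hn
    · subst hn
      exact haff _ Δ U V 𝓕 hΔ hV hF hUV ⟨1, fun _ => 0, fun P => by simp [ArithFormula.poly]⟩
    -- A zero child makes the product zero, and then its factors need not have disjoint variables.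
    by_cases h0 : ∃ i, (child i).poly = 0
    · obtain ⟨i, hi⟩ := h0
      have : (ArithFormula.prod n child).poly = 0 :=
        Finset.prod_eq_zero (Finset.mem_univ i) hi
      rw [this]
      simp only [relRank_zero, zero_mul, Finset.sum_const_zero]
      exact mul_nonneg (Nat.cast_nonneg _) (decayBound_nonneg _ _)
    push Not at h0
    obtain ⟨W, hWV, hcover, hvars, hdisj⟩ := exists_partition hn (fun i => (child i).poly.vars)
      (disjoint_vars_of_isMultilinearPoly_prod (fun i => (child i).poly) hml.1 h0) V
    have hc : ∀ i, (child i).productDepth + 1 ≤ Δ := fun i => by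
      have := Finset.le_sup (f := fun i => (child i).productDepth) (Finset.mem_univ i)
      simp only [ArithFormula.productDepth] at hdepth
      omega
    set J := Finset.univ.filter fun i => (W i).Nonempty with hJ
    have hrel : ∀ ω, relRank V ω (ArithFormula.prod n child).poly ≤
        ∏ i ∈ J, relRank (W i) ω (child i).poly := fun ω =>
      (relRank_prod_le V ω (fun i => (child i).poly) W hWV hcover hvars hdisj).trans
        (Finset.prod_le_prod_of_subset_of_le_one (Finset.filter_subset _ _)
          (fun i _ => relRank_nonneg _ _ _) (fun i _ _ => relRank_le_one _ _ _))
    have hcard : V.card ≤ ∑ i ∈ J, (W i).card := by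
      rw [Finset.sum_filter_of_ne fun i _ h => Finset.card_pos.1 (Nat.pos_of_ne_zero h)]
      exact (Finset.card_le_card hcover).trans Finset.card_biUnion_le
    obtain ⟨Δ, rfl⟩ : ∃ D, Δ = D + 1 := ⟨Δ - 1, by omega⟩
    -- At product-depth one all children are affine, and their families of factors are simply
    -- joined.
    rcases Nat.eq_zero_or_pos Δ with hD | hD
    · subst hD
      have hfam : ∀ i ∈ J, ∃ 𝓖, IsFactorFamily (W i) 𝓖 ∧ (W i).card ≤ 50 * 𝓖.card ∧
          ∀ f : MvPolynomial (IMMVar d) K, IsAffineFunction f →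
            ∀ ω, relRank (W i) ω f ≤ familyWeight 𝓖 ω :=
        fun i hi => exists_family_affine (Finset.mem_filter.1 hi).2
      choose! 𝓖 h1 h2 h3 using hfam
      obtain ⟨𝓗, g1, g2, g3⟩ := exists_family_biUnion J W 𝓖 h1 hdisj
      have g1 : IsFactorFamily V 𝓗 := g1.mono (Finset.biUnion_subset.2 fun i _ => hWV i)
      have hle : ∀ ω, relRank V ω (ArithFormula.prod n child).poly ≤ familyWeight 𝓗 ω := by
        intro ω
        rw [g3]
        refine (hrel ω).trans (Finset.prod_le_prod (fun i _ => relRank_nonneg _ _ _) ?_)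
        intro i hi
        refine h3 i hi _ (isAffineFunction_of_productDepth _ ?_) ω
        have := hc i
        omega
      refine (sum_mul_familyWeight_le hF g1 hUV _ hle).trans ?_
      refine (decayBound_anti d ?_).trans (le_mul_of_one_le_left (decayBound_nonneg _ _)
        (by exact_mod_cast ArithFormula.one_le_size _))
      have h4 := depthExponent_le (Δ := 0 + 1) le_rfl V.card
      have h5 : V.card ≤ 50 * 𝓗.card := by
        rw [g2, Finset.mul_sum]
        exact hcard.trans (Finset.sum_le_sum h2)
      have h6 : (V.card : ℝ) ≤ 50 * 𝓗.card := by exact_mod_cast h5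
      linarith
    · have hJne : J.Nonempty := by
        rw [Finset.nonempty_iff_ne_empty]
        intro he
        rw [he, Finset.sum_empty] at hcard
        have := hV.card_pos
        omega
      -- Only the child with the most variables is followed. Its siblings are bounded by their
      -- balance events, and these join the weights carried in `𝓕`, since the events are not
      -- independent of the child's rank.
      obtain ⟨i, hi, hmax⟩ := Finset.exists_max_image J (fun i => (W i).card) hJne
      obtain ⟨𝓗, g1, g2, g3⟩ := exists_family_biUnion (J.erase i) W (fun j => {(W j, false)})
        (fun j hj => isFactorFamily_singleton (Finset.mem_filter.1 (Finset.mem_of_mem_erase hj)).2)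
        hdisj
      have hsub : (J.erase i).biUnion W ⊆ V := Finset.biUnion_subset.2 fun i _ => hWV i
      obtain ⟨k1, k2, k3⟩ := hF.union g1 (hUV.mono_right hsub)
      have hd' : Disjoint (U ∪ (J.erase i).biUnion W) (W i) := by
        rw [Finset.disjoint_union_left, Finset.disjoint_biUnion_left]
        exact ⟨hUV.mono_right (hWV i), fun j hj => hdisj j i (Finset.ne_of_mem_erase hj)⟩
      have hIH := ih i Δ _ (W i) (𝓕 ∪ 𝓗) hD (hml.2 i) (by have := hc i; omega)
        (Finset.mem_filter.1 hi).2 k1 hd'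
      have hle : ∀ ω, relRank V ω (ArithFormula.prod n child).poly * familyWeight 𝓕 ω ≤
          relRank (W i) ω (child i).poly * familyWeight (𝓕 ∪ 𝓗) ω := by
        intro ω
        rw [k3, mul_comm (familyWeight 𝓕 ω), ← mul_assoc]
        refine mul_le_mul_of_nonneg_right ((hrel ω).trans ?_) (familyWeight_nonneg _ _)
        rw [← Finset.mul_prod_erase J _ hi, g3]
        refine mul_le_mul_of_nonneg_left ?_ (relRank_nonneg _ _ _)
        refine Finset.prod_le_prod (fun j _ => relRank_nonneg _ _ _) fun j _ => ?_
        simpa [familyWeight] using relRank_le_eventWeight (W j) ω (child j).poly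
      have hsize : (child i).size ≤ (ArithFormula.prod n child).size := by
        have := Finset.single_le_sum (f := fun i => (child i).size) (fun _ _ => Nat.zero_le _)
          (Finset.mem_univ i)
        simp only [ArithFormula.size]
        omega
      have hJpos := hJne.card_pos
      have hH : (𝓗.card : ℝ) = J.card - 1 := by
        rw [g2]
        simp only [Finset.card_singleton, Finset.sum_const, smul_eq_mul, mul_one]
        rw [Finset.card_erase_of_mem hi, Nat.cast_sub hJpos, Nat.cast_one]
      have hexp : depthExponent (Δ + 1) V.card ≤ (J.card - 1) + depthExponent Δ (W i).card := by
        refine depthExponent_succ_le hD hJpos (hcard.trans ?_)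
        have := Finset.sum_le_card_nsmul J (fun i => (W i).card) _ hmax
        simpa using this
      calc ∑ ω, relRank V ω (ArithFormula.prod n child).poly * familyWeight 𝓕 ω
          ≤ ∑ ω, relRank (W i) ω (child i).poly * familyWeight (𝓕 ∪ 𝓗) ω :=
            Finset.sum_le_sum fun ω _ => hle ω
        _ ≤ _ := hIH
        _ ≤ (child i).size * decayBound d (𝓕.card + depthExponent (Δ + 1) V.card) := by
            refine mul_le_mul_of_nonneg_left (decayBound_anti d ?_) (Nat.cast_nonneg _)
            rw [k2]
            push_cast
            linarith
        _ ≤ _ := mul_le_mul_of_nonneg_right (by exact_mod_cast hsize) (decayBound_nonneg _ _)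

end FormulaInduction

/-! ### The size bound and the depth bound -/

/-- The average of the relative rank of `IMM` over all restrictions is at least one, while the
formula bounds it by its size times the decay for `4 * d` variables. -/
lemma exp_le_size_of_poly_eq_IMM {K : Type*} [Field K] {d Δ : ℕ} (hd : 1 ≤ d) (hΔ : 1 ≤ Δ)
    (Φ : ArithFormula K (IMMVar d)) (hml : Φ.IsMultilinear) (hdepth : Φ.productDepth ≤ Δ)
    (hpoly : Φ.poly = IMM K d) :
    Real.exp (decayRate * (depthExponent Δ (d * 4) - 16)) ≤ Φ.size := by
  have hne : (Finset.univ : Finset (IMMVar d)).Nonempty := ⟨(⟨0, hd⟩, 0, 0), Finset.mem_univ _⟩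
  have h := sum_relRank_formula_le Φ Δ ∅ Finset.univ ∅ hΔ hml hdepth hne
    ⟨by simp, by simp, by simp, by simp⟩ (by simp)
  have hcard : (Finset.univ : Finset (IMMVar d)).card = d * 4 := by simp
  rw [hpoly, hcard] at h
  have hpos : (0 : ℝ) < Fintype.card (Restriction d) := by exact_mod_cast Fintype.card_pos
  have hlow : (Fintype.card (Restriction d) : ℝ) ≤
      ∑ ω, relRank Finset.univ ω (IMM K d) * familyWeight ∅ ω := by
    calc (Fintype.card (Restriction d) : ℝ) = ∑ _ω : Restriction d, (1 : ℝ) := by simp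
      _ ≤ _ := Finset.sum_le_sum fun ω _ => by simpa [familyWeight] using one_le_relRank_IMM ω
  have h2 := hlow.trans h
  unfold decayBound at h2
  rw [← mul_assoc] at h2
  have h3 := le_of_mul_le_mul_right ((one_mul _).le.trans h2) hpos
  rw [Finset.card_empty, Nat.cast_zero, zero_add, Real.exp_neg, ← div_eq_mul_inv,
    le_div_iff₀ (Real.exp_pos _), one_mul] at h3
  exact h3

/-- A formula with a single gate computes an affine function. This covers the range where the
additive loss 16 makes the exponential bound useless. -/
lemma two_le_size_of_poly_eq_IMM {K : Type*} [Field K] {d : ℕ} (hd : 2 ≤ d)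
    (Φ : ArithFormula K (IMMVar d)) (hpoly : Φ.poly = IMM K d) : 2 ≤ Φ.size := by
  by_contra hlt
  refine not_isAffineFunction_IMM (K := K) hd ?_
  rw [← hpoly]
  cases Φ with
  | var x => exact isAffineFunction_of_productDepth _ rfl
  | const a => exact isAffineFunction_of_productDepth _ rfl
  | sum n w child =>
    rcases Nat.eq_zero_or_pos n with rfl | hn
    · exact isAffineFunction_of_productDepth _ rfl
    · have h1 := Finset.single_le_sum (f := fun i => (child i).size) (fun _ _ => Nat.zero_le _)
        (Finset.mem_univ ⟨0, hn⟩)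
      have h2 := (child ⟨0, hn⟩).one_le_size
      simp only [ArithFormula.size] at hlt
      omega
  | prod n child =>
    rcases Nat.eq_zero_or_pos n with rfl | hn
    · exact ⟨1, fun _ => 0, fun P => by simp [ArithFormula.poly]⟩
    · have h1 := Finset.single_le_sum (f := fun i => (child i).size) (fun _ _ => Nat.zero_le _)
        (Finset.mem_univ ⟨0, hn⟩)
      have h2 := (child ⟨0, hn⟩).one_le_size
      simp only [ArithFormula.size] at hlt
      omega

lemma two_le_of_one_le_logb {d Δ : ℕ} (hΔ : 1 ≤ Δ) (h : (Δ : ℝ) ≤ Real.logb 2 d) : 2 ≤ d := by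
  by_contra hlt
  have h1 : (1 : ℝ) ≤ Δ := by exact_mod_cast hΔ
  interval_cases d <;> simp at h <;> omega

/-- The constant in the exponent of the size lower bound. -/
noncomputable def sizeConstant : ℝ := min (decayRate / 200) (1 / 3200)

lemma sizeConstant_pos : 0 < sizeConstant :=
  lt_min (div_pos decayRate_pos (by norm_num)) (by norm_num)

lemma sizeConstant_le_rate : sizeConstant ≤ decayRate / 200 := min_le_left _ _

lemma sizeConstant_le : sizeConstant ≤ 1 / 3200 := min_le_right _ _

theorem two_rpow_le_size {K : Type*} [Field K] {d Δ : ℕ} (hΔ : 1 ≤ Δ)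
    (hlog : (Δ : ℝ) ≤ Real.logb 2 d) (Φ : ArithFormula K (IMMVar d)) (hml : Φ.IsMultilinear)
    (hdepth : Φ.productDepth ≤ Δ) (hpoly : Φ.poly = IMM K d) :
    (2 : ℝ) ^ (sizeConstant * ((Δ : ℝ) * (d : ℝ) ^ (1 / (Δ : ℝ)))) ≤ Φ.size := by
  have hd := two_le_of_one_le_logb hΔ hlog
  have hd0 : (0 : ℝ) < d := by exact_mod_cast (by omega : 0 < d)
  have hΔ1 : (1 : ℝ) ≤ Δ := by exact_mod_cast hΔ
  have hx : 2 ≤ (d : ℝ) ^ (1 / (Δ : ℝ)) := by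
    have h1 : (2 : ℝ) ^ (Δ : ℝ) ≤ d := (Real.le_logb_iff_rpow_le (by norm_num) hd0).1 hlog
    have h2 := Real.rpow_le_rpow (by positivity) h1 (by positivity : (0 : ℝ) ≤ 1 / Δ)
    rwa [← Real.rpow_mul (by norm_num), mul_one_div_cancel (by positivity), Real.rpow_one] at h2
  have hx4 : (d : ℝ) ^ (1 / (Δ : ℝ)) ≤ ((d * 4 : ℕ) : ℝ) ^ (1 / (Δ : ℝ)) :=
    Real.rpow_le_rpow hd0.le (by push_cast; linarith) (by positivity)
  set E := (Δ : ℝ) * (d : ℝ) ^ (1 / (Δ : ℝ)) with hE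
  have hE0 : 0 < E := by positivity
  have hτ : E / 100 ≤ depthExponent Δ (d * 4) := by
    unfold depthExponent
    have : (d : ℝ) ^ (1 / (Δ : ℝ)) / 2 ≤ ((d * 4 : ℕ) : ℝ) ^ (1 / (Δ : ℝ)) - 1 := by linarith
    have := mul_le_mul_of_nonneg_left this (by linarith : (0 : ℝ) ≤ Δ)
    linarith
  -- Beyond 3200 the loss 16 is at most `E / 200`, half of the gain `E / 100`; below it
  -- `sizeConstant * E ≤ 1`.
  rcases le_total E 3200 with hsmall | hlarge
  · have h1 : sizeConstant * E ≤ 1 := by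
      have := mul_le_mul sizeConstant_le hsmall hE0.le (by norm_num)
      linarith
    calc (2 : ℝ) ^ (sizeConstant * E) ≤ 2 ^ (1 : ℝ) :=
          Real.rpow_le_rpow_of_exponent_le (by norm_num) h1
      _ = 2 := Real.rpow_one 2
      _ ≤ Φ.size := by exact_mod_cast two_le_size_of_poly_eq_IMM hd Φ hpoly
  · have h1 : sizeConstant * E ≤ decayRate * (depthExponent Δ (d * 4) - 16) := by
      have h2 := mul_le_mul_of_nonneg_right sizeConstant_le_rate hE0.le
      have h3 : decayRate * (E / 200) ≤ decayRate * (depthExponent Δ (d * 4) - 16) :=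
        mul_le_mul_of_nonneg_left (by linarith) decayRate_pos.le
      linarith
    calc (2 : ℝ) ^ (sizeConstant * E) = Real.exp (Real.log 2 * (sizeConstant * E)) :=
          Real.rpow_def_of_pos (by norm_num) _
      _ ≤ Real.exp (decayRate * (depthExponent Δ (d * 4) - 16)) := by
          refine Real.exp_le_exp.2 (le_trans ?_ h1)
          have : Real.log 2 ≤ 1 := by linarith [Real.log_two_lt_d9]
          exact mul_le_of_le_one_left (mul_pos sizeConstant_pos hE0).le this
      _ ≤ Φ.size := exp_le_size_of_poly_eq_IMM (by omega) hΔ Φ hml hdepth hpoly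

lemma eval_natPolynomial_le_pow (p : Polynomial ℕ) {d : ℕ} (hd : 2 ≤ d) :
    p.eval d ≤ d ^ (p.eval 1 + p.natDegree) := by
  have h1 : p.eval d ≤ p.eval 1 * d ^ p.natDegree := by
    rw [Polynomial.eval_eq_sum_range, Polynomial.eval_eq_sum_range, Finset.sum_mul]
    refine Finset.sum_le_sum fun i hi => ?_
    rw [one_pow, mul_one]
    exact Nat.mul_le_mul_left _ (Nat.pow_le_pow_right (by omega)
      (Nat.lt_succ_iff.1 (Finset.mem_range.1 hi)))
  rw [pow_add]
  exact h1.trans (Nat.mul_le_mul_right _ (Nat.lt_pow_self (by omega)).le)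

theorem corollary3p3 :
    (∃ c : ℝ, 0 < c ∧
      ∀ (K : Type*) [Field K] (d Δ : ℕ), 1 ≤ Δ → (Δ : ℝ) ≤ Real.logb 2 (d : ℝ) →
        ∀ Φ : ArithFormula K (IMMVar d),
          Φ.IsMultilinear → Φ.productDepth ≤ Δ → Φ.poly = IMM K d →
            (2 : ℝ) ^ (c * ((Δ : ℝ) * (d : ℝ) ^ (1 / (Δ : ℝ)))) ≤ (Φ.size : ℝ)) ∧
    (∀ p : Polynomial ℕ, ∃ c : ℝ, 0 < c ∧
      ∀ (K : Type*) [Field K] (d : ℕ), 1 ≤ d →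
        ∀ Φ : ArithFormula K (IMMVar d),
          Φ.IsMultilinear → Φ.size ≤ p.eval d → Φ.poly = IMM K d →
            c * Real.logb 2 (d : ℝ) ≤ (Φ.productDepth : ℝ)) := by
  refine ⟨⟨sizeConstant, sizeConstant_pos, fun K _ d Δ hΔ hlog Φ hml hdepth hpoly =>
    two_rpow_le_size hΔ hlog Φ hml hdepth hpoly⟩, fun p => ?_⟩
  set k : ℝ := (p.eval 1 + p.natDegree : ℕ) + 1 with hk
  have hk1 : 1 ≤ k := by
    rw [hk]
    exact le_add_of_nonneg_left (Nat.cast_nonneg _)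
  have hc := sizeConstant_pos
  have hc' : 0 < sizeConstant / (8 * k) := by positivity
  refine ⟨min 1 (sizeConstant / (8 * k)), lt_min one_pos hc',
    fun K _ d hd Φ hml hsize hpoly => ?_⟩
  rcases Nat.lt_or_ge d 2 with hd1 | hd2
  · obtain rfl : d = 1 := by omega
    simp
  have hdR : (0 : ℝ) < d := by exact_mod_cast hd
  have hΔ : 1 ≤ Φ.productDepth := by
    by_contra h
    refine not_isAffineFunction_IMM (K := K) hd2 ?_
    rw [← hpoly]
    exact isAffineFunction_of_productDepth Φ (by omega)
  set L := Real.logb 2 (d : ℝ) with hL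
  have hL0 : 0 ≤ L := Real.logb_nonneg (by norm_num) (by exact_mod_cast hd)
  have hΔR : (1 : ℝ) ≤ Φ.productDepth := by exact_mod_cast hΔ
  -- If the depth exceeds `L`, the bound holds because the constant is at most one; otherwise the
  -- size bound applies with `Δ` equal to the depth.
  rcases lt_or_ge L (Φ.productDepth : ℝ) with hlt | hge
  · exact (mul_le_of_le_one_left hL0 (min_le_left _ _)).trans hlt.le
  set D : ℝ := (Φ.productDepth : ℝ) with hD
  have hD0 : 0 < D := by linarith
  have hlow := two_rpow_le_size hΔ hge Φ hml le_rfl hpoly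
  have hdL : (d : ℝ) = 2 ^ L := (Real.rpow_logb (by norm_num) (by norm_num) hdR).symm
  have hup : (Φ.size : ℝ) ≤ 2 ^ (k * L) := by
    have h1 : (Φ.size : ℝ) ≤ (d : ℝ) ^ (p.eval 1 + p.natDegree) := by
      exact_mod_cast hsize.trans (eval_natPolynomial_le_pow p hd2)
    refine h1.trans ?_
    rw [← Real.rpow_natCast, hdL, ← Real.rpow_mul (by norm_num), mul_comm]
    refine Real.rpow_le_rpow_of_exponent_le (by norm_num) (mul_le_mul_of_nonneg_right ?_ hL0)
    rw [hk]
    linarith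
  have hexp := (Real.rpow_le_rpow_left_iff (by norm_num : (1 : ℝ) < 2)).1 (hlow.trans hup)
  have hroot : (d : ℝ) ^ (1 / D) = 2 ^ (L / D) := by
    rw [hdL, ← Real.rpow_mul (by norm_num), mul_one_div]
  -- A quadratic lower bound is needed: a linear one would make `D` cancel in `D * 2 ^ (L / D) ≤ (k
  -- / sizeConstant) * L`.
  have hquad : (L / D) ^ 2 / 8 ≤ (2 : ℝ) ^ (L / D) := by
    have hx : 0 ≤ L / D := by positivity
    rw [Real.rpow_def_of_pos (by norm_num)]
    have hlog : 1 / 2 ≤ Real.log 2 := by linarith [Real.log_two_gt_d9]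
    have hy : L / D / 2 ≤ Real.log 2 * (L / D) := by
      have := mul_le_mul_of_nonneg_right hlog hx
      linarith
    have h1 := Real.quadratic_le_exp_of_nonneg (by positivity : 0 ≤ L / D / 2)
    have h2 := Real.exp_le_exp.2 hy
    have h3 : (L / D / 2) ^ 2 / 2 = (L / D) ^ 2 / 8 := by ring
    linarith
  rw [← hD, hroot] at hexp
  have hmain : sizeConstant * (D * ((L / D) ^ 2 / 8)) ≤ k * L :=
    (mul_le_mul_of_nonneg_left (mul_le_mul_of_nonneg_left hquad hD0.le) hc.le).trans hexp
  have hLpos : 0 < L := by linarith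
  have h5 : sizeConstant * L * L ≤ 8 * k * D * L := by
    have : sizeConstant * (D * ((L / D) ^ 2 / 8)) = sizeConstant * L * L / (8 * D) := by
      field_simp
    rw [this, div_le_iff₀ (by positivity)] at hmain
    linarith
  have h6 : sizeConstant * L ≤ 8 * k * D := le_of_mul_le_mul_right h5 hLpos
  calc min 1 (sizeConstant / (8 * k)) * L ≤ sizeConstant / (8 * k) * L :=
        mul_le_mul_of_nonneg_right (min_le_right _ _) hL0
    _ = sizeConstant * L / (8 * k) := by ring
    _ ≤ D := by
        rw [div_le_iff₀ (by positivity)]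
        linarith
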